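/- Let $p$ be a prime, let $\mathcal F$ be a (not necessarily saturated) fusion system over a finite $p$-group $S$, and let $\mathcal E$ be an $\mathcal F$-invariant subsystem of $\mathcal F$ over a subgroup $T\le S$; that is, $\mathcal E$ is a fusion system over $T$ contained in $\mathcal F$, the subgroup $T$ is strongly closed in $\mathcal F$, every $\alpha\in\mathrm{Aut}_{\mathcal F}(T)$ satisfies ${}^{\alpha}\mathcal E=\mathcal E$, and for every $P\le T$ every $\varphi\in\mathrm{Hom}_{\mathcal F}(P,T)$ is of the form $\varphi=\alpha\circ\varphi_0$ with $\alpha\in\mathrm{Aut}_{\mathcal F}(T)$ and $\varphi_0\in\mathrm{Hom}_{\mathcal E}(P,T)$. Suppose that $\mathcal E$ is saturated. Let $\mathcal E^{cr}$ be the set of all subgroups $P\le T$ such that $C_T(Q)\le Q$ for every $\mathcal E$-conjugate $Q$ of $P$, and $O_p(N_{\mathcal E}(Q))=Q$ for every fully $\mathcal E$-normalized $\mathcal E$-conjugate $Q$ of $P$. (Here $O_p(\mathcal D)$ denotes the largest subgroup that is normal in the fusion system $\mathcal D$.) Let $\Delta$ be a set of subgroups of $S$ such that: 1. $\Delta$ is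 $\mathcal F$-closed, i.e. closed under $\mathcal F$-conjugacy and under taking overgroups in $S$; 2. $\mathcal F$ is $\Delta$-generated, i.e. every morphism of $\mathcal F$ is a product of restrictions of $\mathcal F$-morphisms between subgroups in $\Delta$; 3. $\mathcal F$ is $\Delta$-saturated, i.e. the $\mathcal F$-conjugacy class of each element of $\Delta$ contains a subgroup that is fully automized and receptive in $\mathcal F$; 4. $\mathcal E^{cr}\subseteq\Delta$. Then $\mathcal F$ is saturated, i.e. every subgroup of $S$ is $\mathcal F$-conjugate to a subgroup that is fully automized and receptive in $\mathcal F$. -/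

import Mathlib

open Subgroup

/-- `φ : P → Q` is a restriction of `ψ : P' → Q'` (all four groups being subgroups of `G`):
`P ≤ P'`, `Q ≤ Q'`, and `φ` and `ψ` agree on `P`. -/
def IsRestriction {G : Type*} [Group G] {P Q P' Q' : Subgroup G}
    (φ : P →* Q) (ψ : P' →* Q') : Prop :=
  Q ≤ Q' ∧ ∃ hP : P ≤ P', ∀ x : P, (ψ (inclusion hP x) : G) = (φ x : G)

/-- A fusion system over a subgroup `S` of an ambient group `G`. The objects are the subgroups of
`S`, i.e. the subgroups of `G` contained in `S`; the set of morphisms from `P` to `Q` is a set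
`Hom P Q` of injective group homomorphisms containing all the homomorphisms induced by conjugation
with an element of `S`, and every morphism is an isomorphism of the category followed by an
inclusion. (That `S` is a finite `p`-group is a hypothesis on `S`, imposed where it is used.) -/
structure FusionSystem {G : Type*} [Group G] (S : Subgroup G) where
  /-- the morphisms from `P` to `Q` -/
  Hom : (P Q : Subgroup G) → Set (P →* Q)
  /-- sources of morphisms are subgroups of `S` -/
  source_le : ∀ {P Q : Subgroup G} {φ : P →* Q}, φ ∈ Hom P Q → P ≤ S
  /-- targets of morphisms are subgroups of `S` -/
  target_le : ∀ {P Q : Subgroup G} {φ : P →* Q}, φ ∈ Hom P Q → Q ≤ S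
  /-- morphisms are injective -/
  injective : ∀ {P Q : Subgroup G} {φ : P →* Q}, φ ∈ Hom P Q → Function.Injective φ
  /-- conjugation by an element of `S` is a morphism (`g = 1` gives identities and inclusions) -/
  conj_mem : ∀ {P Q : Subgroup G}, P ≤ S → Q ≤ S → ∀ g ∈ S, ∀ φ : P →* Q,
    (∀ x : P, (φ x : G) = g * (x : G) * g⁻¹) → φ ∈ Hom P Q
  /-- morphisms compose -/
  comp_mem : ∀ {P Q R : Subgroup G} {φ : P →* Q} {ψ : Q →* R},
    φ ∈ Hom P Q → ψ ∈ Hom Q R → ψ.comp φ ∈ Hom P R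
  /-- every morphism is an isomorphism of the category followed by an inclusion -/
  exists_iso : ∀ {P Q : Subgroup G} {φ : P →* Q}, φ ∈ Hom P Q →
    ∃ (R : Subgroup G) (hR : R ≤ Q) (e : P ≃* R), e.toMonoidHom ∈ Hom P R ∧
      e.symm.toMonoidHom ∈ Hom R P ∧ φ = (inclusion hR).comp e.toMonoidHom

/-- `Aut_S(P)`: the automorphisms of `P` induced by conjugation with elements of `N_S(P)`. -/
def autS {G : Type*} [Group G] (S P : Subgroup G) : Subgroup (MulAut P) :=
  (S.subgroupOf (normalizer (P : Set G))).map P.normalizerMonoidHom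

/-- For an isomorphism `e : Q ≃* P`, the group
`N_e = {g ∈ N_S(Q) | e ∘ c_g ∘ e⁻¹ ∈ Aut_S(P)}`. -/
def extender {G : Type*} [Group G] (S : Subgroup G) {Q P : Subgroup G} (e : Q ≃* P) :
    Subgroup G :=
  S ⊓ ((((autS S P).comap (MulAut.congr e).toMonoidHom).comap
    Q.normalizerMonoidHom).map (normalizer (Q : Set G)).subtype)

namespace FusionSystem

variable {G : Type*} [Group G] {S : Subgroup G}

/-- The isomorphisms of the category `F` from `P` to `Q`. -/
def Iso (F : FusionSystem S) (P Q : Subgroup G) : Set (P ≃* Q) :=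
  {e | e.toMonoidHom ∈ F.Hom P Q ∧ e.symm.toMonoidHom ∈ F.Hom Q P}

/-- `P` and `Q` are `F`-conjugate: they are isomorphic objects of `F`. -/
def IsConj (F : FusionSystem S) (P Q : Subgroup G) : Prop :=
  (F.Iso P Q).Nonempty

theorem id_mem (F : FusionSystem S) {P : Subgroup G} (hP : P ≤ S) :
    MonoidHom.id P ∈ F.Hom P P :=
  F.conj_mem hP hP 1 S.one_mem _ (by simp)

/-- `Aut_F(P)`, for an object `P` of `F`. -/
def aut (F : FusionSystem S) (P : Subgroup G) (hP : P ≤ S) : Subgroup (MulAut P) where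
  carrier := {α | α ∈ F.Iso P P}
  one_mem' := ⟨F.id_mem hP, F.id_mem hP⟩
  mul_mem' := fun ha hb => ⟨F.comp_mem hb.1 ha.1, F.comp_mem ha.2 hb.2⟩
  inv_mem' := fun ha => ⟨ha.2, ha.1⟩

/-- `P` is fully automized in `F`: `Aut_S(P)` is a Sylow `p`-subgroup of `Aut_F(P)`. -/
def FullyAutomized (F : FusionSystem S) (p : ℕ) (P : Subgroup G) : Prop :=
  ∃ hP : P ≤ S, ∃ A : Sylow p (F.aut P hP),
    (A : Subgroup (F.aut P hP)).map (F.aut P hP).subtype = autS S P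

/-- `P` is receptive in `F`: each isomorphism `e : Q → P` of `F` extends to a morphism
`N_e → S` of `F`. -/
def Receptive (F : FusionSystem S) (P : Subgroup G) : Prop :=
  P ≤ S ∧ ∀ (Q : Subgroup G), ∀ e ∈ F.Iso Q P,
    ∃ ψ ∈ F.Hom (extender S e) S, IsRestriction e.toMonoidHom ψ

/-- `F` is saturated: every subgroup of `S` is `F`-conjugate to a subgroup that is fully automized
and receptive in `F`. -/
def IsSaturated (F : FusionSystem S) (p : ℕ) : Prop :=
  ∀ P ≤ S, ∃ Q, F.IsConj P Q ∧ F.FullyAutomized p Q ∧ F.Receptive Q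

/-- `P` is fully `F`-normalized: `|N_S(P)| ≥ |N_S(Q)|` for every `F`-conjugate `Q` of `P`. -/
def FullyNormalized (F : FusionSystem S) (P : Subgroup G) : Prop :=
  P ≤ S ∧ ∀ Q, F.IsConj P Q →
    Nat.card (S ⊓ normalizer (Q : Set G) : Subgroup G) ≤
      Nat.card (S ⊓ normalizer (P : Set G) : Subgroup G)

/-- `P` is `F`-centric: `C_S(Q) ≤ Q` for every `F`-conjugate `Q` of `P`. -/
def IsCentric (F : FusionSystem S) (P : Subgroup G) : Prop :=
  P ≤ S ∧ ∀ Q, F.IsConj P Q → S ⊓ centralizer (Q : Set G) ≤ Q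

/-- `Q` is normal in `F`: `Q` is a normal subgroup of `S` and every morphism `P → R` of `F` extends
to a morphism `PQ → RQ` of `F` that maps `Q` onto `Q`. -/
def IsNormal (F : FusionSystem S) (Q : Subgroup G) : Prop :=
  Q ≤ S ∧ S ≤ normalizer (Q : Set G) ∧ ∀ (P R : Subgroup G), ∀ φ ∈ F.Hom P R,
    ∃ ψ ∈ F.Hom (P ⊔ Q) (R ⊔ Q), IsRestriction φ ψ ∧
      ∃ α : Q ≃* Q, IsRestriction α.toMonoidHom ψ

/-- `R = O_p(F)`: `R` is the largest subgroup of `S` that is normal in `F`. -/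
def IsOp (F : FusionSystem S) (R : Subgroup G) : Prop :=
  IsGreatest {Q : Subgroup G | F.IsNormal Q} R

/-- `N_F(Q)`, for an object `Q` of `F`: the fusion system over `N_S(Q)` whose morphisms are the
morphisms `P → R` of `F` between subgroups of `N_S(Q)` that extend to a morphism `PQ → RQ` of `F`
mapping `Q` onto `Q`. -/
def normalizerSystem (F : FusionSystem S) (Q : Subgroup G) (hQ : Q ≤ S) :
    FusionSystem (S ⊓ normalizer (Q : Set G)) where
  Hom P R := {φ | P ≤ S ⊓ normalizer (Q : Set G) ∧ R ≤ S ⊓ normalizer (Q : Set G) ∧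
    φ ∈ F.Hom P R ∧ ∃ ψ ∈ F.Hom (P ⊔ Q) (R ⊔ Q), IsRestriction φ ψ ∧
      ∃ α : Q ≃* Q, IsRestriction α.toMonoidHom ψ}
  source_le h := h.1
  target_le h := h.2.1
  injective h := F.injective h.2.2.1
  conj_mem := by
    intro P R hP hR g hg φ hφ
    have hgQ := mem_normalizer_iff.1 hg.2
    refine ⟨hP, hR, F.conj_mem (hP.trans inf_le_left) (hR.trans inf_le_left) g hg.1 φ hφ, ?_⟩
    have hmap : P ⊔ Q ≤ (R ⊔ Q).comap (MulAut.conj g).toMonoidHom := by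
      refine sup_le (fun x hx => ?_) (fun x hx => ?_)
      · have h1 := hφ ⟨x, hx⟩
        have h2 : g * x * g⁻¹ ∈ R := h1 ▸ (φ ⟨x, hx⟩).2
        exact (le_sup_left : R ≤ R ⊔ Q) h2
      · exact (le_sup_right : Q ≤ R ⊔ Q) ((hgQ x).1 hx)
    let ψ : (P ⊔ Q : Subgroup G) →* (R ⊔ Q : Subgroup G) :=
      ((MulAut.conj g).toMonoidHom.comp (P ⊔ Q).subtype).codRestrict (R ⊔ Q)
        (fun x => hmap x.2)
    refine ⟨ψ, F.conj_mem (sup_le (hP.trans inf_le_left) hQ) (sup_le (hR.trans inf_le_left) hQ)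
      g hg.1 ψ (fun x => rfl), ⟨le_sup_left, le_sup_left, fun x => (hφ x).symm⟩,
      Q.normalizerMonoidHom ⟨g, hg.2⟩, le_sup_right, le_sup_right, fun x => rfl⟩
  comp_mem := by
    rintro P R R' φ φ' ⟨hP, _, hφ, ψ, hψ, ⟨_, h1, h2⟩, α, _, h3, h4⟩
      ⟨_, hR', hφ', ψ', hψ', ⟨_, h1', h2'⟩, α', _, h3', h4'⟩
    refine ⟨hP, hR', F.comp_mem hφ hφ', ψ'.comp ψ, F.comp_mem hψ hψ',
      ⟨le_sup_left, le_sup_left, fun x => ?_⟩, α.trans α', le_sup_right, le_sup_right,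
      fun x => ?_⟩
    · have h : ψ (inclusion h1 x) = inclusion h1' (φ x) := Subtype.ext (h2 x)
      exact (congrArg (fun y => (ψ' y : G)) h).trans (h2' (φ x))
    · have h : ψ (inclusion h3 x) = inclusion h3' (α x) := Subtype.ext (h4 x)
      exact (congrArg (fun y => (ψ' y : G)) h).trans (h4' (α x))
  exists_iso := by
    rintro P R φ ⟨hP, hR, hφ, ψ, hψ, ⟨_, h1, h2⟩, α, _, h3, h4⟩
    obtain ⟨P', hP'R, e, he, he', rfl⟩ := F.exists_iso hφ
    obtain ⟨M, hM, f, hf, hf', rfl⟩ := F.exists_iso hψ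
    replace h2 : ∀ x : P, (f (inclusion h1 x) : G) = e x := h2
    replace h4 : ∀ x : Q, (f (inclusion h3 x) : G) = α x := h4
    have hM' : M = P' ⊔ Q := by
      apply le_antisymm
      · have hle : P ⊔ Q ≤ ((P' ⊔ Q).comap (M.subtype.comp f.toMonoidHom)).map
            (P ⊔ Q).subtype := by
          refine sup_le (fun x hx => ?_) (fun x hx => ?_)
          · refine ⟨inclusion h1 ⟨x, hx⟩, ?_, rfl⟩
            change (f (inclusion h1 ⟨x, hx⟩) : G) ∈ P' ⊔ Q
            rw [h2]
            exact (le_sup_left : P' ≤ P' ⊔ Q) (e ⟨x, hx⟩).2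
          · refine ⟨inclusion h3 ⟨x, hx⟩, ?_, rfl⟩
            change (f (inclusion h3 ⟨x, hx⟩) : G) ∈ P' ⊔ Q
            rw [h4]
            exact (le_sup_right : Q ≤ P' ⊔ Q) (α ⟨x, hx⟩).2
        intro m hm
        obtain ⟨z, hz, hz'⟩ := hle (f.symm ⟨m, hm⟩).2
        have : z = f.symm ⟨m, hm⟩ := Subtype.ext hz'
        subst this
        have h : ((f (f.symm ⟨m, hm⟩) : M) : G) ∈ P' ⊔ Q := hz
        rwa [f.apply_symm_apply] at h
      · refine sup_le (fun x hx => ?_) (fun x hx => ?_)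
        · have h := h2 (e.symm ⟨x, hx⟩)
          rw [e.apply_symm_apply] at h
          exact (show (_ : G) = x from h) ▸ (f _).2
        · have h := h4 (α.symm ⟨x, hx⟩)
          rw [α.apply_symm_apply] at h
          exact (show (_ : G) = x from h) ▸ (f _).2
    subst hM'
    refine ⟨P', hP'R, e, ⟨hP, hP'R.trans hR, he, f.toMonoidHom, hf,
      ⟨le_sup_left, le_sup_left, h2⟩, α, le_sup_right, le_sup_right, h4⟩,
      ⟨hP'R.trans hR, hP, he', f.symm.toMonoidHom, hf',
      ⟨le_sup_left, le_sup_left, fun x => ?_⟩, α.symm, le_sup_right, le_sup_right,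
      fun x => ?_⟩, rfl⟩
    · have h : inclusion le_sup_left x = f (inclusion h1 (e.symm x)) :=
        Subtype.ext ((h2 (e.symm x)).trans (by simp)).symm
      change ((f.symm (inclusion le_sup_left x) : (P ⊔ Q : Subgroup G)) : G) = e.symm x
      rw [h, f.symm_apply_apply]; rfl
    · have h : inclusion le_sup_right x = f (inclusion h3 (α.symm x)) :=
        Subtype.ext ((h4 (α.symm x)).trans (by simp)).symm
      change ((f.symm (inclusion le_sup_right x) : (P ⊔ Q : Subgroup G)) : G) = α.symm x
      rw [h, f.symm_apply_apply]; rfl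

/-- The set `F^{cr}` of subgroups of `S` that are centric radical in `F`: `P` is centric, and
`O_p(N_F(Q)) = Q` for every fully `F`-normalized `F`-conjugate `Q` of `P`. -/
def centricRadical (F : FusionSystem S) : Set (Subgroup G) :=
  {P | F.IsCentric P ∧ ∀ (Q : Subgroup G) (hQ : Q ≤ S), F.IsConj P Q → F.FullyNormalized Q →
    (F.normalizerSystem Q hQ).IsOp Q}

/-- `Δ` is an `F`-closed set of subgroups of `S`: it is closed under `F`-conjugacy and under
taking overgroups in `S`. -/
def IsClosedSet (F : FusionSystem S) (Δ : Set (Subgroup G)) : Prop :=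
  (∀ P ∈ Δ, P ≤ S) ∧ (∀ P ∈ Δ, ∀ Q, F.IsConj P Q → Q ∈ Δ) ∧
    (∀ P ∈ Δ, ∀ Q, P ≤ Q → Q ≤ S → Q ∈ Δ)

/-- The homomorphisms that are products of restrictions of `F`-morphisms between members
of `Δ`. -/
inductive ProductOfRestrictions (F : FusionSystem S) (Δ : Set (Subgroup G)) :
    ∀ {P Q : Subgroup G}, (P →* Q) → Prop
  | restriction {P Q R R' : Subgroup G} {φ : P →* Q} {ψ : R →* R'} (hR : R ∈ Δ) (hR' : R' ∈ Δ)
      (hψ : ψ ∈ F.Hom R R') (h : IsRestriction φ ψ) : ProductOfRestrictions F Δ φ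
  | comp {P Q R : Subgroup G} {φ : P →* Q} {ψ : Q →* R} (hφ : ProductOfRestrictions F Δ φ)
      (hψ : ProductOfRestrictions F Δ ψ) : ProductOfRestrictions F Δ (ψ.comp φ)

/-- `F` is `Δ`-generated: every morphism of `F` is a product of restrictions of `F`-morphisms
between members of `Δ`. -/
def IsGeneratedBy (F : FusionSystem S) (Δ : Set (Subgroup G)) : Prop :=
  ∀ (P Q : Subgroup G), ∀ φ ∈ F.Hom P Q, F.ProductOfRestrictions Δ φ

/-- `F` is `Δ`-saturated: the `F`-conjugacy class of every member of `Δ` contains a subgroup that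
is fully automized and receptive in `F`. -/
def IsSaturatedOn (F : FusionSystem S) (p : ℕ) (Δ : Set (Subgroup G)) : Prop :=
  ∀ P ∈ Δ, ∃ Q, F.IsConj P Q ∧ F.FullyAutomized p Q ∧ F.Receptive Q

/-- `E`, a fusion system over `T`, is a subsystem of `F`. -/
def IsSubsystem {T : Subgroup G} (E : FusionSystem T) (F : FusionSystem S) : Prop :=
  T ≤ S ∧ ∀ P Q : Subgroup G, E.Hom P Q ⊆ F.Hom P Q

/-- `T` is strongly closed in `F`: every `F`-morphism maps elements of `T` to elements of `T`. -/
def StronglyClosed (F : FusionSystem S) (T : Subgroup G) : Prop :=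
  T ≤ S ∧ ∀ (P Q : Subgroup G), ∀ φ ∈ F.Hom P Q, ∀ x : P, (x : G) ∈ T → (φ x : G) ∈ T

/-- `E`, a fusion system over `T`, is an `F`-invariant subsystem of `F`: it is a subsystem, `T` is
strongly closed in `F`, every `α ∈ Aut_F(T)` satisfies `α E α⁻¹ = E` (invariance condition), and
every `φ ∈ Hom_F(P, T)` with `P ≤ T` is `α ∘ φ₀` for some `α ∈ Aut_F(T)` and `φ₀ ∈ Hom_E(P, T)`
(Frattini condition).

In the invariance condition `a : P ≃* P'` and `b : Q ≃* Q'` are restrictions of `α`, so that `P'`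
and `Q'` are the images of `P` and `Q` under `α`. -/
def IsInvariantSubsystem {T : Subgroup G} (E : FusionSystem T) (F : FusionSystem S) : Prop :=
  E.IsSubsystem F ∧ F.StronglyClosed T ∧
  (∀ α ∈ F.Iso T T, ∀ (P P' Q Q' : Subgroup G) (a : P ≃* P') (b : Q ≃* Q'),
    IsRestriction a.toMonoidHom α.toMonoidHom → IsRestriction b.toMonoidHom α.toMonoidHom →
    ∀ φ : P →* Q, φ ∈ E.Hom P Q ↔
      (b.toMonoidHom.comp φ).comp a.symm.toMonoidHom ∈ E.Hom P' Q') ∧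
  (∀ P ≤ T, ∀ φ ∈ F.Hom P T, ∃ α ∈ F.Iso T T, ∃ φ₀ ∈ E.Hom P T, φ = α.toMonoidHom.comp φ₀)

end FusionSystem

/-!
Otherwise choose `P ≤ S` at which `F` is not saturated with the pair `(|P ∩ T|, |P|)`
lexicographically maximal, so that `F` is saturated at every subgroup of `S` properly containing a
conjugate of `P`, and at every subgroup of `T` properly containing `Q ∩ T` for a conjugate `Q`. The
conjugates of `P` lie outside `Δ`; as `Δ` is closed under overgroups, their intersections with `T`
are not centric radical in `E`.

Write `K(P)` for the group of elements of `N_S(P)` that act on `P` as elements of `O_p(Aut_F(P))`.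
Since `E` is saturated, some `E`-conjugate of `P ∩ T` has an analogous group, formed in `E`, that is
not contained in it. Saturation of `F` at `N_T(P ∩ T)` together with the invariance of `E` moves
this property to a conjugate `W` of `P`. The automorphisms of `W` that act trivially on
`W / (W ∩ T)`, and as elements of `O_p(Aut_E(W ∩ T))` on `W ∩ T`, form a normal `p`-subgroup of
`Aut_F(W)`; hence `K(W)` is not contained in `W`.

For such a `W` whose normalizer has maximal order among the conjugates, every morphism between
conjugates of `W` is a product of isomorphisms defined on larger subgroups of their normalizers,
because `F` is `Δ`-generated. Downward induction on the orders of these larger subgroups, where `F`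
is saturated, yields that every conjugate embeds its normalizer into `N_S(W)`, and then that every
automorphism of `W` extends to `K(W)`. As `F` is saturated at `K(W) > W`, this makes `F` saturated
at `W`, a contradiction.
-/

section Groups

variable {M M' : Type*} [Group M] [Group M'] {p : ℕ}

theorem lt_inf_normalizer [Fact p.Prime] {P H : Subgroup M} [Finite H] (hp : IsPGroup p H)
    (h : P < H) : P < H ⊓ normalizer (P : Set M) := by
  have := hp.isNilpotent
  have hlt : P.subgroupOf H < ⊤ := by
    rw [lt_top_iff_ne_top, Ne, subgroupOf_eq_top]
    exact not_le_of_gt h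
  obtain ⟨m, hm, hmP⟩ := SetLike.exists_of_lt (Group.normalizerCondition_of_isNilpotent _ hlt)
  rw [← subgroupOf_normalizer_eq h.le] at hm
  exact lt_of_le_of_ne (le_inf h.le le_normalizer) fun heq =>
    hmP (heq ▸ (⟨m.2, hm⟩ : (m : M) ∈ H ⊓ normalizer (P : Set M)))

/-- `O_p(A)`, the largest normal `p`-subgroup of a subgroup `A`. -/
def pCore (p : ℕ) (A : Subgroup M) : Subgroup M :=
  (sSup {N : Subgroup A | N.Normal ∧ IsPGroup p N}).map A.subtype

theorem pCore_le (A : Subgroup M) : pCore p A ≤ A :=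
  map_subtype_le _

theorem isPGroup_pCore (A : Subgroup M) : IsPGroup p (pCore p A) := by
  have (N : {N : Subgroup A | N.Normal ∧ IsPGroup p N}) : (N : Subgroup A).Normal := N.2.1
  refine IsPGroup.map ?_ _
  rw [sSup_eq_iSup']
  exact Sylow.iSup_of_normal _ fun N => N.2.2

theorem le_normalizer_pCore (A : Subgroup M) : A ≤ normalizer (pCore p A : Set M) := by
  have (N : {N : Subgroup A | N.Normal ∧ IsPGroup p N}) : (N : Subgroup A).Normal := N.2.1
  have : (sSup {N : Subgroup A | N.Normal ∧ IsPGroup p N}).Normal := by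
    rw [sSup_eq_iSup']
    infer_instance
  rw [← normal_subgroupOf_iff_le_normalizer (pCore_le A), pCore, subgroupOf,
    comap_map_eq_self_of_injective A.subtype_injective]
  exact this

theorem le_pCore {A N : Subgroup M} (hNA : N ≤ A) (hn : A ≤ normalizer (N : Set M))
    (hp : IsPGroup p N) : N ≤ pCore p A := by
  rw [← map_subgroupOf_eq_of_le hNA]
  exact map_mono (le_sSup ⟨(normal_subgroupOf_iff_le_normalizer hNA).2 hn,
    hp.of_equiv (subgroupOfEquivOfLe hNA).symm⟩)

theorem map_pCore_le (A : Subgroup M) (φ : M →* M') :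
    (pCore p A).map φ ≤ pCore p (A.map φ) :=
  le_pCore (map_mono (pCore_le A))
    ((map_mono (le_normalizer_pCore A)).trans (le_normalizer_map φ)) ((isPGroup_pCore A).map φ)

/-- `W` is a Sylow `p`-subgroup of `H`, both being subgroups of a common group. -/
def IsSylowIn (p : ℕ) (W H : Subgroup M) : Prop :=
  Maximal (fun V => V ≤ H ∧ IsPGroup p V) W

namespace IsSylowIn

variable {W H : Subgroup M}

theorem le (h : IsSylowIn p W H) : W ≤ H :=
  h.prop.1

theorem isPGroup (h : IsSylowIn p W H) : IsPGroup p W :=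
  h.prop.2

theorem mono {L : Subgroup M} (h : IsSylowIn p W H) (hWL : W ≤ L) (hLH : L ≤ H) :
    IsSylowIn p W L :=
  Maximal.mono h (fun _ hV => ⟨hV.1.trans hLH, hV.2⟩) ⟨hWL, h.isPGroup⟩

theorem map (h : IsSylowIn p W H) (φ : M ≃* M') :
    IsSylowIn p (W.map φ.toMonoidHom) (H.map φ.toMonoidHom) := by
  refine ⟨⟨map_mono h.le, h.isPGroup.map _⟩, fun V hV hWV => ?_⟩
  have hVW : W ≤ V.comap φ.toMonoidHom := map_le_iff_le_comap.1 hWV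
  rw [comap_equiv_eq_map_symm'] at hVW
  have hVH : V.map φ.symm.toMonoidHom ≤ H := by
    rw [← comap_equiv_eq_map_symm',
      ← comap_map_eq_self_of_injective (f := φ.toMonoidHom) φ.injective H]
    exact comap_mono hV.1
  have hle : V.map φ.symm.toMonoidHom ≤ W := h.le_of_ge ⟨hVH, hV.2.map _⟩ hVW
  rwa [map_equiv_eq_comap_symm', ← map_le_iff_le_comap]

end IsSylowIn

theorem isSylowIn_iff_exists_sylow {W H : Subgroup M} :
    IsSylowIn p W H ↔ ∃ A : Sylow p H, (A : Subgroup H).map H.subtype = W := by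
  constructor
  · intro h
    refine ⟨⟨W.subgroupOf H, h.isPGroup.of_equiv (subgroupOfEquivOfLe h.le).symm,
      fun {V} hV hWV => ?_⟩, map_subgroupOf_eq_of_le h.le⟩
    have : V.map H.subtype ≤ W :=
      h.le_of_ge ⟨map_subtype_le V, hV.map _⟩
        ((map_subgroupOf_eq_of_le h.le).ge.trans (map_mono hWV))
    exact hWV.antisymm' (map_le_iff_le_comap.1 this)
  · rintro ⟨A, rfl⟩
    refine ⟨⟨map_subtype_le _, A.isPGroup'.map _⟩, fun V hV hAV => ?_⟩
    rw [← A.is_maximal' (hV.2.of_equiv (subgroupOfEquivOfLe hV.1).symm)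
      (map_le_iff_le_comap.1 hAV), map_subgroupOf_eq_of_le hV.1]

theorem exists_le_isSylowIn {B H : Subgroup M} (hB : B ≤ H) (hBp : IsPGroup p B) :
    ∃ W, B ≤ W ∧ IsSylowIn p W H := by
  obtain ⟨A, hA⟩ := (hBp.of_equiv (subgroupOfEquivOfLe hB).symm).exists_le_sylow
  exact ⟨_, (map_subgroupOf_eq_of_le hB).ge.trans (map_mono hA),
    isSylowIn_iff_exists_sylow.2 ⟨A, rfl⟩⟩

namespace IsSylowIn

variable {W H N B : Subgroup M} [Fact p.Prime] [Finite H]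

theorem exists_conj_mem (h : IsSylowIn p W H) (hB : B ≤ H) (hBp : IsPGroup p B) :
    ∃ g ∈ H, ∀ b ∈ B, g * b * g⁻¹ ∈ W := by
  obtain ⟨A, rfl⟩ := isSylowIn_iff_exists_sylow.1 h
  obtain ⟨C, hC⟩ := (hBp.of_equiv (subgroupOfEquivOfLe hB).symm).exists_le_sylow
  obtain ⟨g, rfl⟩ := MulAction.exists_smul_eq H C A
  exact ⟨g, g.2, fun b hb => ⟨g * ⟨b, hB hb⟩ * g⁻¹,
    smul_mem_pointwise_smul (⟨b, hB hb⟩ : H) (MulAut.conj g) (C : Subgroup H) (hC hb), rfl⟩⟩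

theorem exists_conj_mem_of_le_sup (h : IsSylowIn p W H) (hNH : N ≤ H)
    (hN : H ≤ normalizer (N : Set M)) (hB : B ≤ W ⊔ N) (hBp : IsPGroup p B) :
    ∃ n ∈ N, ∀ b ∈ B, n * b * n⁻¹ ∈ W := by
  have hLH : W ⊔ N ≤ H := sup_le h.le hNH
  have : Finite (W ⊔ N : Subgroup M) := Finite.of_injective _ (inclusion_injective hLH)
  obtain ⟨g, hg, hgB⟩ := (h.mono le_sup_left hLH).exists_conj_mem hB hBp
  rw [← SetLike.mem_coe, coe_mul_of_left_le_normalizer_right _ _ (h.le.trans hN)] at hg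
  obtain ⟨w, hw, n, hn, rfl⟩ := hg
  refine ⟨n, hn, fun b hb => ?_⟩
  have := W.mul_mem (W.mul_mem (W.inv_mem hw) (hgB b hb)) hw
  convert this using 1
  group

theorem le_sup_of_pow_mem {O : Subgroup M} (h : IsSylowIn p W H) (hNH : N ≤ H)
    (hN : H ≤ normalizer (N : Set M)) (hOH : O ≤ H) (hO : H ≤ normalizer (O : Set M))
    (hp : ∀ a ∈ O, ∃ k : ℕ, a ^ p ^ k ∈ N) : O ≤ W ⊔ N := by
  obtain ⟨A, rfl⟩ := isSylowIn_iff_exists_sylow.1 h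
  have := (normal_subgroupOf_iff_le_normalizer hNH).2 hN
  have := (normal_subgroupOf_iff_le_normalizer hOH).2 hO
  let f := QuotientGroup.mk' (N.subgroupOf H)
  have hf : Function.Surjective f := QuotientGroup.mk'_surjective _
  have : ((O.subgroupOf H).map f).Normal := Normal.map inferInstance f hf
  have hOp : IsPGroup p ((O.subgroupOf H).map f) := by
    rintro ⟨_, b, hb, rfl⟩
    obtain ⟨k, hk⟩ := hp b (mem_subgroupOf.1 hb)
    exact ⟨k, Subtype.ext ((QuotientGroup.eq_one_iff (b ^ p ^ k)).2 hk)⟩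
  intro a ha
  obtain ⟨w, hw, hwa⟩ := hOp.le_sylow_of_normal (A.mapSurjective hf)
    ⟨⟨a, hOH ha⟩, mem_subgroupOf.2 ha, rfl⟩
  rw [← mul_inv_cancel_left (w : M) a]
  exact mul_mem (mem_sup_left ⟨w, hw, rfl⟩)
    (mem_sup_right (mem_subgroupOf.1 (QuotientGroup.eq.1 hwa)))

end IsSylowIn

end Groups

section Morphisms

variable {G : Type*} [Group G] {S : Subgroup G}

/-- `N_S(P)`, for an arbitrary subgroup `P` of the ambient group. -/
abbrev normalizerIn (S P : Subgroup G) : Subgroup G :=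
  S ⊓ normalizer (P : Set G)

namespace FusionSystem

variable {F : FusionSystem S} {f g : G → G} {P Q R P' Q' : Subgroup G} {x y : G}

/-- The function `f` restricts to an isomorphism `P → Q` of the fusion system `F`. Isomorphisms are
handled through functions on the ambient group, so that composing, restricting and extending them
involves no coercions between subgroups. -/
def MapsOnto (F : FusionSystem S) (f : G → G) (P Q : Subgroup G) : Prop :=
  ∃ e ∈ F.Iso P Q, ∀ x : P, (e x : G) = f x

/-- The function `f` restricts to an isomorphism of the fusion system `F` from `P` onto some
subgroup. -/
def MapsOn (F : FusionSystem S) (f : G → G) (P : Subgroup G) : Prop :=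
  ∃ Q, F.MapsOnto f P Q

theorem exists_mapsOnto {e : P ≃* Q} (he : e ∈ F.Iso P Q) :
    ∃ f, F.MapsOnto f P Q ∧ ∀ x : P, (e x : G) = f x :=
  have h (x : P) : (e x : G) = Function.extend Subtype.val (fun y : P => (e y : G)) id x :=
    (Subtype.val_injective.extend_apply (fun y : P => (e y : G)) id x).symm
  ⟨_, ⟨e, he, h⟩, h⟩

theorem exists_mapsOnto_of_hom {φ : P →* Q} (hφ : φ ∈ F.Hom P Q) :
    ∃ f, ∃ R ≤ Q, F.MapsOnto f P R ∧ ∀ x : P, (φ x : G) = f x := by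
  obtain ⟨R, hR, e, he, he', rfl⟩ := F.exists_iso hφ
  obtain ⟨f, hf, hef⟩ := exists_mapsOnto (F := F) (e := e) ⟨he, he'⟩
  exact ⟨f, R, hR, hf, hef⟩

theorem inclusion_mem_hom (h : P ≤ Q) (hQ : Q ≤ S) : inclusion h ∈ F.Hom P Q :=
  F.conj_mem (h.trans hQ) hQ 1 S.one_mem _ (by simp)

namespace MapsOnto

theorem mapsOn (h : F.MapsOnto f P Q) : F.MapsOn f P :=
  ⟨Q, h⟩

theorem source_le (h : F.MapsOnto f P Q) : P ≤ S :=
  have ⟨_, he, _⟩ := h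
  F.source_le he.1

theorem target_le (h : F.MapsOnto f P Q) : Q ≤ S :=
  have ⟨_, he, _⟩ := h
  F.target_le he.1

theorem isConj (h : F.MapsOnto f P Q) : F.IsConj P Q :=
  have ⟨e, he, _⟩ := h
  ⟨e, he⟩

theorem bijOn (h : F.MapsOnto f P Q) : Set.BijOn f P Q := by
  obtain ⟨e, -, h⟩ := h
  refine ⟨fun x hx => h ⟨x, hx⟩ ▸ (e ⟨x, hx⟩).2, fun x hx y hy hxy => ?_, fun y hy => ?_⟩
  · rw [← h ⟨x, hx⟩, ← h ⟨y, hy⟩] at hxy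
    exact congrArg Subtype.val (e.injective (Subtype.ext hxy))
  · exact ⟨e.symm ⟨y, hy⟩, (e.symm ⟨y, hy⟩).2, by rw [← h, e.apply_symm_apply]⟩

theorem apply_mem (h : F.MapsOnto f P Q) (hx : x ∈ P) : f x ∈ Q :=
  h.bijOn.mapsTo hx

theorem map_mul (h : F.MapsOnto f P Q) (hx : x ∈ P) (hy : y ∈ P) : f (x * y) = f x * f y := by
  obtain ⟨e, -, h⟩ := h
  rw [← h ⟨x, hx⟩, ← h ⟨y, hy⟩, ← h ⟨x * y, P.mul_mem hx hy⟩, ← Subgroup.coe_mul,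
    ← _root_.map_mul]
  rfl

theorem map_inv (h : F.MapsOnto f P Q) (hx : x ∈ P) : f x⁻¹ = (f x)⁻¹ := by
  obtain ⟨e, -, h⟩ := h
  rw [← h ⟨x, hx⟩, ← h ⟨x⁻¹, P.inv_mem hx⟩, ← Subgroup.coe_inv, ← _root_.map_inv]
  rfl

theorem map_conj (h : F.MapsOnto f P Q) (hy : y ∈ P) (hx : x ∈ P) :
    f (y * x * y⁻¹) = f y * f x * (f y)⁻¹ := by
  rw [h.map_mul (P.mul_mem hy hx) (P.inv_mem hy), h.map_mul hy hx, h.map_inv hy]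

theorem card_eq (h : F.MapsOnto f P Q) : Nat.card P = Nat.card Q :=
  have ⟨e, _, _⟩ := h
  Nat.card_congr e.toEquiv

theorem congr (h : F.MapsOnto f P Q) (hfg : Set.EqOn g f P) : F.MapsOnto g P Q :=
  have ⟨e, he, h⟩ := h
  ⟨e, he, fun x => by rw [h, hfg x.2]⟩

theorem comp (h : F.MapsOnto f P Q) (h' : F.MapsOnto g Q R) : F.MapsOnto (g ∘ f) P R := by
  obtain ⟨e, he, h⟩ := h
  obtain ⟨e', he', h'⟩ := h'
  refine ⟨e.trans e', ⟨F.comp_mem he.1 he'.1, F.comp_mem he'.2 he.2⟩, fun x => ?_⟩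
  rw [Function.comp_apply, ← h, ← h']
  rfl

theorem of_leftInvOn (h : F.MapsOnto f P Q) (hg : Set.LeftInvOn g f P) : F.MapsOnto g Q P := by
  obtain ⟨e, he, h⟩ := h
  refine ⟨e.symm, ⟨he.2, he.1⟩, fun y => ?_⟩
  obtain ⟨x, rfl⟩ := e.surjective y
  rw [e.symm_apply_apply, h, hg x.2]

theorem exists_invOn (h : F.MapsOnto f P Q) : ∃ g, F.MapsOnto g Q P ∧ Set.InvOn g f P Q :=
  ⟨_, h.of_leftInvOn h.bijOn.invOn_invFunOn.1, h.bijOn.invOn_invFunOn⟩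

theorem target_mono (h : F.MapsOnto f P Q) (h' : F.MapsOnto f P' Q') (hP : P' ≤ P) : Q' ≤ Q := by
  rw [← SetLike.coe_subset_coe, ← h.bijOn.image_eq, ← h'.bijOn.image_eq]
  exact Set.image_mono hP

theorem target_le_of_mapsTo (h : F.MapsOnto f P Q) (h' : Set.MapsTo f P R) : Q ≤ R := by
  rw [← SetLike.coe_subset_coe, ← h.bijOn.image_eq]
  exact h'.image_subset

theorem target_unique (h : F.MapsOnto f P Q) (h' : F.MapsOnto f P Q') : Q = Q' :=
  le_antisymm (h'.target_mono h le_rfl) (h.target_mono h' le_rfl)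

theorem mem_iff (h : F.MapsOnto f P Q) (h' : F.MapsOnto f P' Q') (hP : P' ≤ P) (hx : x ∈ P) :
    f x ∈ Q' ↔ x ∈ P' := by
  refine ⟨fun hx' => ?_, h'.apply_mem⟩
  obtain ⟨y, hy, hyx⟩ := h'.bijOn.surjOn hx'
  exact h.bijOn.injOn (hP hy) hx hyx ▸ hy

theorem apply_mem_normalizer (h : F.MapsOnto f P Q) (h' : F.MapsOnto f P' Q') (hP : P' ≤ P)
    (hx : x ∈ P) (hn : x ∈ normalizer (P' : Set G)) : f x ∈ normalizer (Q' : Set G) := by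
  refine mem_normalizer_iff.2 fun z => ⟨fun hz => ?_, fun hz => ?_⟩
  · obtain ⟨y, hy, rfl⟩ := h'.bijOn.surjOn hz
    rw [← h.map_conj hx (hP hy)]
    exact h'.apply_mem ((mem_normalizer_iff.1 hn y).1 hy)
  · obtain ⟨y, hy, hyz⟩ := h'.bijOn.surjOn hz
    have hy' := (mem_normalizer_iff''.1 hn y).1 hy
    have hconj := h.map_conj hx (hP hy')
    rw [show x * (x⁻¹ * y * x) * x⁻¹ = y by group, hyz, mul_left_inj, mul_right_inj] at hconj
    exact hconj ▸ h'.apply_mem hy'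

theorem le_normalizerIn (h : F.MapsOnto f P Q) (h' : F.MapsOnto f P' Q') (hP : P' ≤ P)
    (hn : P ≤ normalizer (P' : Set G)) : Q ≤ normalizerIn S Q' :=
  h.target_le_of_mapsTo fun _ hx =>
    ⟨h.target_le (h.apply_mem hx), h.apply_mem_normalizer h' hP hx (hn hx)⟩

theorem exists_hom (h : F.MapsOnto f P Q) (hP : P' ≤ P) (hQ : Q ≤ Q') (hQ' : Q' ≤ S) :
    ∃ φ ∈ F.Hom P' Q', ∀ x : P', (φ x : G) = f x :=
  have ⟨_, he, h⟩ := h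
  ⟨_, F.comp_mem (inclusion_mem_hom hP (F.source_le he.1))
    (F.comp_mem he.1 (inclusion_mem_hom hQ hQ')), fun x => h (inclusion hP x)⟩

end MapsOnto

namespace MapsOn

theorem source_le (h : F.MapsOn f P) : P ≤ S :=
  have ⟨_, h⟩ := h
  h.source_le

theorem mono (h : F.MapsOn f P) (hP : P' ≤ P) : F.MapsOn f P' := by
  obtain ⟨Q, h⟩ := h
  obtain ⟨φ, hφ, hφf⟩ := h.exists_hom hP le_rfl h.target_le
  obtain ⟨f', Q', -, hf', hφf'⟩ := exists_mapsOnto_of_hom hφ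
  exact ⟨Q', hf'.congr fun x hx => (hφf ⟨x, hx⟩).symm.trans (hφf' ⟨x, hx⟩)⟩

theorem mapsOnto (h : F.MapsOn f P) (hPQ : f '' P = Q) : F.MapsOnto f P Q := by
  obtain ⟨R, h⟩ := h
  exact SetLike.coe_injective (h.bijOn.image_eq.symm.trans hPQ) ▸ h

end MapsOn

theorem mapsOnto_id (hP : P ≤ S) : F.MapsOnto id P P :=
  ⟨MulEquiv.refl P, ⟨F.id_mem hP, F.id_mem hP⟩, fun _ => rfl⟩

theorem mapsOnto_conj (hP : P ≤ S) {s : G} (hs : s ∈ normalizerIn S P) :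
    F.MapsOnto (MulAut.conj s) P P := by
  refine ⟨P.normalizerMonoidHom ⟨s, hs.2⟩, ⟨F.conj_mem hP hP s hs.1 _ fun x => rfl,
    F.conj_mem hP hP s⁻¹ (S.inv_mem hs.1) _ fun x => ?_⟩, fun x => rfl⟩
  obtain ⟨y, rfl⟩ := (P.normalizerMonoidHom ⟨s, hs.2⟩).surjective x
  change (((P.normalizerMonoidHom ⟨s, hs.2⟩).symm _ : P) : G) = s⁻¹ * (s * y * s⁻¹) * s⁻¹⁻¹
  rw [MulEquiv.symm_apply_apply]
  group

theorem mem_aut_of_mapsOnto {hP : P ≤ S} {a : MulAut P} (h : F.MapsOnto f P P)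
    (ha : ∀ x : P, (a x : G) = f x) : a ∈ F.aut P hP := by
  obtain ⟨e, he, h⟩ := h
  have : a = e := MulEquiv.ext fun x => Subtype.ext ((ha x).trans (h x).symm)
  exact this ▸ he

end FusionSystem

end Morphisms

section Extensions

variable {G : Type*} [Group G] {S : Subgroup G} {p : ℕ}

theorem mem_autS_iff {N P : Subgroup G} {a : MulAut P} :
    a ∈ autS N P ↔ ∃ s ∈ normalizerIn N P, ∀ x : P, (a x : G) = s * x * s⁻¹ := by
  constructor
  · rintro ⟨s, hs, rfl⟩
    exact ⟨s, ⟨mem_subgroupOf.1 hs, s.2⟩, fun x => rfl⟩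
  · rintro ⟨s, hs, h⟩
    exact ⟨⟨s, hs.2⟩, mem_subgroupOf.2 hs.1, MulEquiv.ext fun x => Subtype.ext (h x).symm⟩

theorem isPGroup_autS {N : Subgroup G} (hN : IsPGroup p N) (P : Subgroup G) :
    IsPGroup p (autS N P) := by
  refine IsPGroup.map (fun ⟨g, hg⟩ => ?_) _
  obtain ⟨k, hk⟩ := hN ⟨g, mem_subgroupOf.1 hg⟩
  exact ⟨k, Subtype.ext (Subtype.ext (congrArg (fun n : N => (n : G)) hk))⟩

theorem finite_of_le [Finite S] {P : Subgroup G} (hP : P ≤ S) : Finite P :=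
  Finite.of_injective _ (inclusion_injective hP)

theorem autS_mono {N N' : Subgroup G} (h : N ≤ N') (P : Subgroup G) : autS N P ≤ autS N' P :=
  map_mono (comap_mono h)

section Extender

variable {P Q N : Subgroup G} {e : Q ≃* P}

theorem extender_le_normalizerIn : extender S e ≤ normalizerIn S Q := by
  rintro _ ⟨hS, n, -, rfl⟩
  exact ⟨hS, n.2⟩

theorem map_autS_extender_le :
    (autS (extender S e) Q).map (MulAut.congr e).toMonoidHom ≤ autS S P := by
  rintro _ ⟨_, ⟨n, ⟨-, n', hn', hnn'⟩, rfl⟩, rfl⟩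
  exact Subtype.ext hnn' ▸ hn'

theorem le_extender (hN : N ≤ normalizerIn S Q)
    (h : (autS N Q).map (MulAut.congr e).toMonoidHom ≤ autS S P) : N ≤ extender S e :=
  fun n hn => ⟨(hN hn).1, ⟨n, (hN hn).2⟩,
    h ⟨_, ⟨⟨n, (hN hn).2⟩, mem_subgroupOf.2 hn, rfl⟩, rfl⟩, rfl⟩

theorem source_le_extender (hQ : Q ≤ S) (hP : P ≤ S) : Q ≤ extender S e := by
  refine le_extender (le_inf hQ le_normalizer) ?_
  rintro _ ⟨_, ⟨y, hy, rfl⟩, rfl⟩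
  have hy' : (y : G) ∈ Q := mem_subgroupOf.1 hy
  refine mem_autS_iff.2 ⟨e ⟨y, hy'⟩, ⟨hP (e _).2, le_normalizer (e _).2⟩, fun x => ?_⟩
  obtain ⟨x, rfl⟩ := e.surjective x
  have hx : MulAut.congr e (Q.normalizerMonoidHom y) (e x) = e (⟨y, hy'⟩ * x * ⟨y, hy'⟩⁻¹) :=
    congrArg (fun z => e (Q.normalizerMonoidHom y z)) (e.symm_apply_apply x)
  rw [map_mul, map_mul, map_inv] at hx
  exact congrArg Subtype.val hx

end Extender

namespace FusionSystem

variable {F : FusionSystem S} {f : G → G} {P Q R R' X Z N : Subgroup G}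

theorem autS_le_aut (hP : P ≤ S) : autS S P ≤ F.aut P hP := by
  intro a ha
  obtain ⟨s, hs, h⟩ := mem_autS_iff.1 ha
  exact mem_aut_of_mapsOnto (mapsOnto_conj hP hs) h

theorem map_aut_le {e : P ≃* Q} (he : e ∈ F.Iso P Q) (hP : P ≤ S) (hQ : Q ≤ S) :
    (F.aut P hP).map (MulAut.congr e).toMonoidHom ≤ F.aut Q hQ := by
  rintro _ ⟨a, ha, rfl⟩
  exact ⟨F.comp_mem (F.comp_mem he.2 ha.1) he.1, F.comp_mem (F.comp_mem he.2 ha.2) he.1⟩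

theorem map_aut {e : P ≃* Q} (he : e ∈ F.Iso P Q) (hP : P ≤ S) (hQ : Q ≤ S) :
    (F.aut P hP).map (MulAut.congr e).toMonoidHom = F.aut Q hQ := by
  refine le_antisymm (map_aut_le he hP hQ) ?_
  rw [map_equiv_eq_comap_symm', ← map_le_iff_le_comap]
  exact map_aut_le (e := e.symm) ⟨he.2, he.1⟩ hQ hP

theorem Receptive.exists_extension (hP : F.Receptive P) {e : Q ≃* P} (he : e ∈ F.Iso Q P)
    (hN : N ≤ normalizerIn S Q) (h : (autS N Q).map (MulAut.congr e).toMonoidHom ≤ autS S P) :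
    ∃ f, F.MapsOn f (Q ⊔ N) ∧ ∀ x : Q, f x = e x := by
  obtain ⟨ψ, hψ, -, hle, hψe⟩ := hP.2 Q e he
  obtain ⟨f, B, -, hf, hψf⟩ := exists_mapsOnto_of_hom hψ
  exact ⟨f, hf.mapsOn.mono (sup_le hle (le_extender hN h)), fun x =>
    (hψf (inclusion hle x)).symm.trans (hψe x)⟩

theorem receptive_of_forall (hP : P ≤ S)
    (h : ∀ Q, ∀ e ∈ F.Iso Q P, ∃ f, F.MapsOn f (extender S e) ∧ ∀ x : Q, f x = e x) :
    F.Receptive P := by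
  refine ⟨hP, fun Q e he => ?_⟩
  obtain ⟨f, ⟨B, hf⟩, hfe⟩ := h Q e he
  obtain ⟨φ, hφ, hφf⟩ := hf.exists_hom le_rfl hf.target_le le_rfl
  exact ⟨φ, hφ, hP, source_le_extender (F.source_le he.1) hP, fun x => (hφf _).trans (hfe x)⟩

theorem MapsOnto.exists_iso_restrict (hf : F.MapsOnto f R' R) (hfX : F.MapsOnto f X Z)
    (hX : X ≤ R') (hZ : Z ≤ R) : ∃ e ∈ F.Iso R' R, ∃ e₀ ∈ F.Iso X Z,
      (∀ x : R', (e x : G) = f x) ∧ ∀ x, e (inclusion hX x) = inclusion hZ (e₀ x) := by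
  obtain ⟨e, he, hef⟩ := hf
  obtain ⟨e₀, he₀, hef₀⟩ := hfX
  exact ⟨e, he, e₀, he₀, hef, fun x => Subtype.ext ((hef _).trans (hef₀ x).symm)⟩

/-- The group of automorphisms of `R` in `F` that restrict to a member of `C` on the subgroup
`Z`. -/
def autOver (F : FusionSystem S) (hR : R ≤ S) (hZ : Z ≤ R) (C : Subgroup (MulAut Z)) :
    Subgroup (MulAut R) where
  carrier := {a | a ∈ F.aut R hR ∧ ∃ c ∈ C, ∀ z, a (inclusion hZ z) = inclusion hZ (c z)}
  one_mem' := ⟨one_mem _, 1, one_mem _, fun _ => rfl⟩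
  mul_mem' := by
    rintro a b ⟨ha, c, hc, hac⟩ ⟨hb, d, hd, hbd⟩
    refine ⟨mul_mem ha hb, c * d, mul_mem hc hd, fun z => ?_⟩
    rw [MulAut.mul_apply, hbd, hac, MulAut.mul_apply]
  inv_mem' := by
    rintro a ⟨ha, c, hc, hac⟩
    refine ⟨inv_mem ha, c⁻¹, inv_mem hc, fun z => ?_⟩
    rw [← MulAut.inv_apply_self _ a (inclusion hZ (c⁻¹ z)), hac, MulAut.apply_inv_self]

/-- The group of automorphisms of `R` in `F` that map the subgroup `Z` onto itself. -/
abbrev autStab (F : FusionSystem S) (hR : R ≤ S) (hZ : Z ≤ R) : Subgroup (MulAut R) :=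
  F.autOver hR hZ (F.aut Z (hZ.trans hR))

section AutOver

variable {hR : R ≤ S} {hZ : Z ≤ R} {hR' : R' ≤ S} {hX : X ≤ R'} {C D : Subgroup (MulAut Z)}

theorem autOver_mono (h : C ≤ D) : F.autOver hR hZ C ≤ F.autOver hR hZ D :=
  fun _ ⟨ha, c, hc, hac⟩ => ⟨ha, c, h hc, hac⟩

theorem mem_autStab_iff {a : MulAut R} : a ∈ F.autStab hR hZ ↔
    ∃ f, F.MapsOnto f R R ∧ F.MapsOnto f Z Z ∧ ∀ x : R, (a x : G) = f x := by
  constructor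
  · rintro ⟨ha, c, hc, hac⟩
    obtain ⟨f, hf, haf⟩ := exists_mapsOnto ha
    exact ⟨f, hf, ⟨c, hc, fun z =>
      (congrArg Subtype.val (hac z)).symm.trans (haf (inclusion hZ z))⟩, haf⟩
  · rintro ⟨f, hf, ⟨c, hc, hcf⟩, haf⟩
    exact ⟨mem_aut_of_mapsOnto hf haf, c, hc, fun z =>
      Subtype.ext ((haf (inclusion hZ z)).trans (hcf z).symm)⟩

theorem autOver_le_normalizer (h : D ≤ normalizer (C : Set (MulAut Z))) :
    F.autOver hR hZ D ≤ normalizer (F.autOver hR hZ C : Set (MulAut R)) := by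
  have conj_mem {a b : MulAut R} (ha : a ∈ F.autOver hR hZ D) (hb : b ∈ F.autOver hR hZ C) :
      a * b * a⁻¹ ∈ F.autOver hR hZ C := by
    have ⟨d, _, had⟩ := (inv_mem ha).2
    obtain ⟨ha, d', hd', had'⟩ := ha
    obtain ⟨hb, c, hc, hbc⟩ := hb
    have hinv : d = d'⁻¹ := by
      refine eq_inv_of_mul_eq_one_right (MulEquiv.ext fun z => inclusion_injective hZ ?_)
      rw [MulAut.mul_apply, ← had', ← had, MulAut.apply_inv_self, MulAut.one_apply]
    refine ⟨mul_mem (mul_mem ha hb) (inv_mem ha), d' * c * d, ?_, fun z => ?_⟩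
    · exact hinv ▸ (mem_normalizer_iff.1 (h hd') c).1 hc
    · simp only [MulAut.mul_apply, had, hbc, had']
  refine fun a ha => mem_normalizer_iff.2 fun b => ⟨conj_mem ha, fun hb => ?_⟩
  have := conj_mem (inv_mem ha) hb
  rwa [show a⁻¹ * (a * b * a⁻¹) * a⁻¹⁻¹ = b by group] at this

theorem autOver_bot_le_autStab : F.autOver hR hZ ⊥ ≤ F.autStab hR hZ :=
  autOver_mono bot_le

theorem autStab_le_normalizer_autOver_bot :
    F.autStab hR hZ ≤ normalizer (F.autOver hR hZ ⊥ : Set (MulAut R)) :=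
  autOver_le_normalizer (normalizer_eq_top (H := (⊥ : Subgroup (MulAut Z))) ▸ le_top)

theorem pow_mem_autOver {a : MulAut R} (ha : a ∈ F.autOver hR hZ C) {n : ℕ}
    (h : ∀ c ∈ C, c ^ n ∈ D) : a ^ n ∈ F.autOver hR hZ D := by
  obtain ⟨ha, c, hc, hac⟩ := ha
  have hpow (k : ℕ) : ∀ z, (a ^ k) (inclusion hZ z) = inclusion hZ ((c ^ k) z) := by
    induction k with
    | zero => exact fun _ => rfl
    | succ k ih =>
      intro z
      rw [pow_succ', pow_succ', MulAut.mul_apply, MulAut.mul_apply, ih, hac]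
  exact ⟨pow_mem ha n, c ^ n, h c hc, hpow n⟩

theorem map_autOver_le {e : R' ≃* R} (he : e ∈ F.Iso R' R) {e₀ : X ≃* Z}
    (h : ∀ x, e (inclusion hX x) = inclusion hZ (e₀ x)) (C : Subgroup (MulAut X)) :
    (F.autOver hR' hX C).map (MulAut.congr e).toMonoidHom ≤
      F.autOver hR hZ (C.map (MulAut.congr e₀).toMonoidHom) := by
  rintro _ ⟨a, ⟨ha, c, hc, hac⟩, rfl⟩
  refine ⟨map_aut_le he hR' hR ⟨a, ha, rfl⟩, _, ⟨c, hc, rfl⟩, fun z => ?_⟩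
  obtain ⟨x, rfl⟩ := e₀.surjective z
  change e (a (e.symm (inclusion hZ (e₀ x)))) = inclusion hZ (e₀ (c (e₀.symm (e₀ x))))
  rw [← h, ← h, e.symm_apply_apply, e₀.symm_apply_apply, hac]

theorem map_autOver {e : R' ≃* R} (he : e ∈ F.Iso R' R) {e₀ : X ≃* Z}
    (h : ∀ x, e (inclusion hX x) = inclusion hZ (e₀ x)) (C : Subgroup (MulAut X)) :
    (F.autOver hR' hX C).map (MulAut.congr e).toMonoidHom =
      F.autOver hR hZ (C.map (MulAut.congr e₀).toMonoidHom) := by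
  refine le_antisymm (map_autOver_le he h C) ?_
  rw [map_equiv_eq_comap_symm' (MulAut.congr e), ← map_le_iff_le_comap]
  refine (map_autOver_le (hR := hR') (hZ := hX) (e := e.symm) (e₀ := e₀.symm) ⟨he.2, he.1⟩
    (fun z => ?_) _).trans ?_
  · rw [MulEquiv.symm_apply_eq, h, MulEquiv.apply_symm_apply]
  · refine autOver_mono ?_
    rw [map_le_iff_le_comap, map_equiv_eq_comap_symm']
    rfl

theorem autS_le_autOver (hR : R ≤ S) (hN : N ≤ normalizerIn S R)
    (hNZ : N ≤ normalizer (Z : Set G)) : autS N R ≤ F.autOver hR hZ (autS N Z) := by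
  rintro _ ⟨n, hn, rfl⟩
  have hnN := mem_subgroupOf.1 hn
  exact ⟨mem_aut_of_mapsOnto (mapsOnto_conj hR (hN hnN)) fun x => rfl,
    Z.normalizerMonoidHom ⟨n, hNZ hnN⟩, ⟨_, mem_subgroupOf.2 hnN, rfl⟩, fun z => rfl⟩

theorem isPGroup_autS_inf (hS : IsPGroup p S) (H : Subgroup (MulAut R)) :
    IsPGroup p (autS S R ⊓ H : Subgroup (MulAut R)) :=
  (isPGroup_autS hS R).to_le inf_le_left

theorem autOver_le_sup [Fact p.Prime] [Finite S] {W H : Subgroup (MulAut R)}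
    (h : IsSylowIn p W H) (hH : H ≤ F.autStab hR hZ) (hC : IsPGroup p C)
    (hCH : F.autOver hR hZ C ≤ H) (hn : H ≤ normalizer (F.autOver hR hZ C : Set (MulAut R))) :
    F.autOver hR hZ C ≤ W ⊔ F.autOver hR hZ ⊥ := by
  have := finite_of_le hR
  have := finite_of_le (hZ.trans hR)
  refine h.le_sup_of_pow_mem ((autOver_mono bot_le).trans hCH)
    (hH.trans autStab_le_normalizer_autOver_bot) hCH hn fun a ha => ?_
  obtain ⟨k, hk⟩ := IsPGroup.iff_card.1 hC
  refine ⟨k, pow_mem_autOver ha fun c hc => mem_bot.2 ?_⟩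
  rw [← hk]
  exact congrArg Subtype.val (pow_card_eq_one' (x := (⟨c, hc⟩ : C)))

end AutOver

/-- The pair `Z ≤ R` is well placed: `R` is receptive, and the automorphisms of `R` that are induced
by `S` and map `Z` onto itself form a Sylow `p`-subgroup of those in `F` that do so. Such pairs are
the targets towards which isomorphisms of pairs are extended. -/
def WellPlaced (F : FusionSystem S) (p : ℕ) (R Z : Subgroup G) : Prop :=
  ∃ (hR : R ≤ S) (hZ : Z ≤ R), F.Receptive R ∧
    IsSylowIn p (autS S R ⊓ F.autStab hR hZ) (F.autStab hR hZ)

theorem exists_wellPlaced [Fact p.Prime] [Finite S] (hS : IsPGroup p S)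
    (ha : F.FullyAutomized p R) (hr : F.Receptive R) (hX : X ≤ R) :
    ∃ f Z, F.MapsOnto f R R ∧ F.MapsOnto f X Z ∧ F.WellPlaced p R Z := by
  obtain ⟨hR, hA⟩ := ha
  have := finite_of_le hR
  obtain ⟨B, -, hB⟩ := exists_le_isSylowIn (bot_le : ⊥ ≤ F.autStab hR hX) IsPGroup.of_bot
  obtain ⟨a, haF, haB⟩ := (isSylowIn_iff_exists_sylow.2 hA).exists_conj_mem
    (hB.le.trans fun _ h => h.1) hB.isPGroup
  obtain ⟨f, hf, haf⟩ := exists_mapsOnto haF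
  obtain ⟨Z, hfZ⟩ := hf.mapsOn.mono hX
  have hZ : Z ≤ R := hf.target_mono hfZ hX
  obtain ⟨e, he, e₀, he₀, hef, hcomp⟩ := hf.exists_iso_restrict hfZ hX hZ
  obtain rfl : e = a := MulEquiv.ext fun x => Subtype.ext ((hef x).trans (haf x).symm)
  have hstab := map_autOver (hR := hR) (hR' := hR) he hcomp (F.aut X (hX.trans hR))
  rw [map_aut he₀ (hX.trans hR) (hZ.trans hR)] at hstab
  have hsyl := hB.map (MulAut.congr e)
  rw [hstab] at hsyl
  have hle : B.map (MulAut.congr e).toMonoidHom ≤ autS S R ⊓ F.autStab hR hZ := by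
    refine le_inf ?_ hsyl.le
    rintro _ ⟨b, hb, rfl⟩
    exact haB b hb
  have heq := hsyl.eq_of_le ⟨inf_le_right, isPGroup_autS_inf hS _⟩ hle
  exact ⟨f, Z, hf, hfZ, hR, hZ, hr, heq ▸ hsyl⟩

theorem Receptive.exists_extension_trans {hR : R ≤ S} (hr : F.Receptive R) {e : R' ≃* R}
    (he : e ∈ F.Iso R' R) {a : MulAut R} (ha : a ∈ F.aut R hR) (hN : N ≤ normalizerIn S R')
    (h : ∀ b ∈ (autS N R').map (MulAut.congr e).toMonoidHom, a * b * a⁻¹ ∈ autS S R) :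
    ∃ f, F.MapsOn f (R' ⊔ N) ∧ F.MapsOnto f R' R ∧ ∀ x : R', f x = a (e x) := by
  have hea : e.trans a ∈ F.Iso R' R := ⟨F.comp_mem he.1 ha.1, F.comp_mem ha.2 he.2⟩
  obtain ⟨f, hf, hfe⟩ := hr.exists_extension hea hN (by
    rintro _ ⟨b, hb, rfl⟩
    exact h _ ⟨b, hb, rfl⟩)
  exact ⟨f, hf, ⟨_, hea, fun x => (hfe x).symm⟩, hfe⟩

namespace WellPlaced

variable [Fact p.Prime] [Finite S]

theorem exists_extension_of_le_sup (hS : IsPGroup p S) {hR : R ≤ S} {hZ : Z ≤ R} {hX : X ≤ R'}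
    {C : Subgroup (MulAut Z)} (hw : F.WellPlaced p R Z) {e : R' ≃* R} (he : e ∈ F.Iso R' R)
    {e₀ : X ≃* Z} (hcomp : ∀ x, e (inclusion hX x) = inclusion hZ (e₀ x))
    (hN : N ≤ normalizerIn S R') (hNX : N ≤ normalizer (X : Set G))
    (hC : (autS N X).map (MulAut.congr e₀).toMonoidHom ≤ C)
    (hsup : F.autOver hR hZ C ≤ autS S R ⊓ F.autStab hR hZ ⊔ F.autOver hR hZ ⊥) :
    ∃ h, F.MapsOn h (R' ⊔ N) ∧ F.MapsOnto h R' R ∧ ∀ x : X, h x = e₀ x := by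
  obtain ⟨_, _, hr, hsyl⟩ := hw
  have hR' := F.source_le he.1
  have := finite_of_le hR
  have hle : (autS N R').map (MulAut.congr e).toMonoidHom ≤ F.autOver hR hZ C :=
    (map_mono (autS_le_autOver hR' hN hNX)).trans
      ((map_autOver_le he hcomp _).trans (autOver_mono hC))
  obtain ⟨a, ⟨ha, c, hc, hac⟩, haN⟩ := hsyl.exists_conj_mem_of_le_sup autOver_bot_le_autStab
    autStab_le_normalizer_autOver_bot (hle.trans hsup)
    ((isPGroup_autS (hS.to_le (hN.trans inf_le_left)) R').map _)
  obtain ⟨h, hh, hhR, hhe⟩ := hr.exists_extension_trans he ha hN fun b hb => (haN b hb).1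
  refine ⟨h, hh, hhR, fun x => ?_⟩
  rw [mem_bot.1 hc] at hac
  rw [← coe_inclusion hX x, hhe, hcomp, hac]
  rfl

theorem exists_extension_normalizerIn (hS : IsPGroup p S) (hw : F.WellPlaced p R Z)
    (hf : F.MapsOnto f R' R) (hfX : F.MapsOnto f X Z) (hX : X ≤ R') :
    ∃ h, F.MapsOn h (R' ⊔ normalizerIn S R' ⊓ normalizer (X : Set G)) ∧
      F.MapsOnto h R' R ∧ F.MapsOnto h X Z := by
  obtain ⟨hR, hZ, hr, hsyl⟩ := hw
  obtain ⟨e, he, e₀, he₀, hef, hcomp⟩ := hf.exists_iso_restrict hfX hX hZ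
  have hR' := hf.source_le
  have := finite_of_le hR
  have hle : (autS (normalizerIn S R' ⊓ normalizer (X : Set G)) R').map
      (MulAut.congr e).toMonoidHom ≤ F.autStab hR hZ := by
    refine (map_mono ((autS_le_autOver hR' inf_le_left inf_le_right).trans (autOver_mono
      ((autS_mono (inf_le_left.trans inf_le_left) X).trans
        (autS_le_aut (hX.trans hR')))))).trans (map_autOver_le he hcomp _) |>.trans
      (autOver_mono (map_aut_le he₀ _ _))
  obtain ⟨a, ha, haN⟩ := hsyl.exists_conj_mem hle
    ((isPGroup_autS (hS.to_le (inf_le_left.trans inf_le_left)) R').map _)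
  obtain ⟨h, hh, hhR, hhe⟩ :=
    hr.exists_extension_trans he ha.1 inf_le_left fun b hb => (haN b hb).1
  obtain ⟨g, -, hgZ, hag⟩ := mem_autStab_iff.1 ha
  refine ⟨h, hh, hhR, (hfX.comp hgZ).congr fun x hx => ?_⟩
  rw [hhe ⟨x, hX hx⟩, hag, hef]
  rfl

end WellPlaced

/-- The elements of `N_S(P)` that act on `P` as elements of `O_p(Aut_F(P))`. -/
def coreIn (F : FusionSystem S) (p : ℕ) (P : Subgroup G) (hP : P ≤ S) : Subgroup G :=
  S ⊓ ((pCore p (F.aut P hP)).comap P.normalizerMonoidHom).map (normalizer (P : Set G)).subtype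

section CoreIn

variable {hP : P ≤ S} {hX : X ≤ S}

theorem coreIn_le_normalizerIn : F.coreIn p P hP ≤ normalizerIn S P :=
  inf_le_inf_left S (map_subtype_le _)

theorem mem_coreIn_iff {x : G} : x ∈ F.coreIn p P hP ↔
    x ∈ S ∧ ∃ a ∈ pCore p (F.aut P hP), ∃ hx : x ∈ normalizer (P : Set G),
      P.normalizerMonoidHom ⟨x, hx⟩ = a := by
  constructor
  · rintro ⟨hS, n, hn, rfl⟩
    exact ⟨hS, _, hn, n.2, rfl⟩
  · rintro ⟨hS, _, hn, hx, rfl⟩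
    exact ⟨hS, ⟨x, hx⟩, hn, rfl⟩

theorem autS_coreIn_le : autS (F.coreIn p P hP) P ≤ pCore p (F.aut P hP) := by
  rintro _ ⟨n, ⟨-, n', hn', hnn'⟩, rfl⟩
  exact Subtype.ext hnn' ▸ hn'

theorem WellPlaced.exists_extension_coreIn [Fact p.Prime] [Finite S] (hS : IsPGroup p S)
    (hw : F.WellPlaced p R Z) (hf : F.MapsOnto f R' R) (hfX : F.MapsOnto f X Z) (hXR : X ≤ R') :
    ∃ h, F.MapsOn h (R' ⊔ F.coreIn p X hX ⊓ normalizer (R' : Set G)) ∧ F.MapsOnto h R' R ∧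
      Set.EqOn h f X := by
  obtain ⟨hR, hZ, -, hsyl⟩ := id hw
  obtain ⟨e, he, e₀, he₀, hef, hcomp⟩ := hf.exists_iso_restrict hfX hXR hZ
  have hcore : F.coreIn p X hX ⊓ normalizer (R' : Set G) ≤ F.coreIn p X hX := inf_le_left
  obtain ⟨h, hh, hhR, hhe⟩ := hw.exists_extension_of_le_sup hS he hcomp
    (inf_le_inf_right _ inf_le_left) (hcore.trans (coreIn_le_normalizerIn.trans inf_le_right))
    (map_aut he₀ hX (hZ.trans hR) ▸
      (map_mono ((autS_mono hcore X).trans autS_coreIn_le)).trans (map_pCore_le _ _))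
    (autOver_le_sup hsyl le_rfl (isPGroup_pCore _) (autOver_mono (pCore_le _))
      (autOver_le_normalizer (le_normalizer_pCore _)))
  exact ⟨h, hh, hhR, fun x hx => (hhe ⟨x, hx⟩).trans
    ((congrArg Subtype.val (hcomp ⟨x, hx⟩)).symm.trans (hef _))⟩

end CoreIn

end FusionSystem

end Extensions

section Confluence

variable {G : Type*} [Group G] {S : Subgroup G} {p : ℕ}

theorem card_le_card_of_le [Finite S] {P Q : Subgroup G} (h : P ≤ Q) (hQ : Q ≤ S) :
    Nat.card P ≤ Nat.card Q :=
  have := finite_of_le hQ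
  card_le_of_le h

theorem card_lt_card_of_lt [Finite S] {P Q : Subgroup G} (h : P < Q) (hQ : Q ≤ S) :
    Nat.card P < Nat.card Q :=
  have := finite_of_le hQ
  lt_of_not_ge fun hc => h.ne (eq_of_le_of_card_ge h.le hc)

theorem card_pos_of_le [Finite S] {P : Subgroup G} (hP : P ≤ S) : 0 < Nat.card P :=
  have := finite_of_le hP
  Nat.card_pos

theorem le_normalizerIn_self {P : Subgroup G} (hP : P ≤ S) : P ≤ normalizerIn S P :=
  le_inf hP le_normalizer

namespace FusionSystem

variable {F : FusionSystem S} {f g : G → G} {P Q Q' Q'' R R' W W' X Z : Subgroup G} {n : ℕ}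

theorem MapsOnto.target_lt (h : F.MapsOnto f R R') (h' : F.MapsOnto f Q Q') (hQ : Q < R) :
    Q' < R' :=
  ⟨h.target_mono h' hQ.le, fun hle => hQ.not_ge fun _ hx =>
    (h.mem_iff h' hQ.le hx).1 (hle (h.apply_mem hx))⟩

namespace IsConj

theorem exists_mapsOnto (h : F.IsConj P Q) : ∃ f, F.MapsOnto f P Q :=
  have ⟨_, he⟩ := h
  have ⟨f, hf, _⟩ := FusionSystem.exists_mapsOnto he
  ⟨f, hf⟩

theorem symm (h : F.IsConj P Q) : F.IsConj Q P :=
  have ⟨e, he⟩ := h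
  ⟨e.symm, he.2, he.1⟩

theorem trans (h : F.IsConj P Q) (h' : F.IsConj Q R) : F.IsConj P R :=
  have ⟨e, he⟩ := h
  have ⟨e', he'⟩ := h'
  ⟨e.trans e', F.comp_mem he.1 he'.1, F.comp_mem he'.2 he.2⟩

end IsConj

/-- `F` is saturated at `P`: some `F`-conjugate of `P` is fully automized and receptive. -/
def IsSaturatedAt (F : FusionSystem S) (p : ℕ) (P : Subgroup G) : Prop :=
  ∃ Q, F.IsConj P Q ∧ F.FullyAutomized p Q ∧ F.Receptive Q

/-- `F` is saturated at every subgroup of `S` that properly contains an `F`-conjugate of `P`. -/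
def IsSaturatedAbove (F : FusionSystem S) (p : ℕ) (P : Subgroup G) : Prop :=
  ∀ Q, F.IsConj P Q → ∀ R ≤ S, Q < R → F.IsSaturatedAt p R

theorem IsSaturatedAt.of_isConj (h : F.IsSaturatedAt p P) (hPQ : F.IsConj P Q) :
    F.IsSaturatedAt p Q :=
  have ⟨R, hR, h⟩ := h
  ⟨R, hPQ.symm.trans hR, h⟩

section

variable [Fact p.Prime] [Finite S]

theorem IsSaturatedAt.exists_wellPlaced (hS : IsPGroup p S) (h : F.IsSaturatedAt p R)
    (hX : X ≤ R) : ∃ f R' Z, F.MapsOnto f R R' ∧ F.MapsOnto f X Z ∧ F.WellPlaced p R' Z := by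
  obtain ⟨R', hRR', ha, hr⟩ := h
  obtain ⟨f, hf⟩ := hRR'.exists_mapsOnto
  obtain ⟨Y, hfY⟩ := hf.mapsOn.mono hX
  obtain ⟨g, Z, hg, hgZ, hw⟩ := FusionSystem.exists_wellPlaced hS ha hr (hf.target_mono hfY hX)
  exact ⟨g ∘ f, R', Z, hf.comp hg, hfY.comp hgZ, hw⟩

theorem IsSaturatedAt.exists_common_extension (hS : IsPGroup p S) (h : F.IsSaturatedAt p R)
    (hf : F.MapsOnto f R R') (hfQ : F.MapsOnto f Q Q') (hQ : Q ≤ R) :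
    ∃ R₀ Z, F.WellPlaced p R₀ Z ∧
      (∃ u, F.MapsOn u (R ⊔ normalizerIn S R ⊓ normalizer (Q : Set G)) ∧
        F.MapsOnto u R R₀ ∧ F.MapsOnto u Q Z) ∧
      ∃ u, F.MapsOn u (R' ⊔ normalizerIn S R' ⊓ normalizer (Q' : Set G)) ∧
        F.MapsOnto u R' R₀ ∧ F.MapsOnto u Q' Z := by
  obtain ⟨c, R₀, Z, hc, hcZ, hw⟩ := h.exists_wellPlaced hS hQ
  obtain ⟨g, hg, hgf, -⟩ := hf.exists_invOn
  exact ⟨R₀, Z, hw, hw.exists_extension_normalizerIn hS hc hcZ hQ,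
    hw.exists_extension_normalizerIn hS (hg.comp hc)
      ((hfQ.of_leftInvOn (hgf.mono hQ)).comp hcZ) (hf.target_mono hfQ hQ)⟩

end

/-- Some isomorphism `Q → Q'` of `F` extends to `N_S(Q)`. -/
def NormalizerEmbeds (F : FusionSystem S) (Q Q' : Subgroup G) : Prop :=
  ∃ f, F.MapsOn f (normalizerIn S Q) ∧ F.MapsOnto f Q Q'

namespace NormalizerEmbeds

theorem refl (hQ : Q ≤ S) : F.NormalizerEmbeds Q Q :=
  ⟨id, (mapsOnto_id inf_le_left).mapsOn, mapsOnto_id hQ⟩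

theorem isConj (h : F.NormalizerEmbeds Q Q') : F.IsConj Q Q' :=
  have ⟨_, _, hf⟩ := h
  hf.isConj

theorem trans (h : F.NormalizerEmbeds Q Q') (h' : F.NormalizerEmbeds Q' Q'') :
    F.NormalizerEmbeds Q Q'' := by
  obtain ⟨f, ⟨B, hB⟩, hQ⟩ := h
  obtain ⟨g, hg, hQ'⟩ := h'
  obtain ⟨C, hC⟩ := hg.mono (hB.le_normalizerIn hQ (le_normalizerIn_self hQ.source_le) inf_le_right)
  exact ⟨g ∘ f, (hB.comp hC).mapsOn, hQ.comp hQ'⟩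

end NormalizerEmbeds

theorem MapsOnto.target_eq_normalizerIn [Finite S] (hB : F.MapsOnto f (normalizerIn S Q) R)
    (hQ : F.MapsOnto f Q Q') (hc : Nat.card (normalizerIn S Q') ≤ Nat.card (normalizerIn S Q)) :
    R = normalizerIn S Q' :=
  have := finite_of_le (inf_le_left : normalizerIn S Q' ≤ S)
  eq_of_le_of_card_ge (hB.le_normalizerIn hQ (le_normalizerIn_self hQ.source_le) inf_le_right)
    (hB.card_eq ▸ hc)

theorem NormalizerEmbeds.symm_of_card_le [Finite S] (h : F.NormalizerEmbeds Q Q')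
    (hc : Nat.card (normalizerIn S Q') ≤ Nat.card (normalizerIn S Q)) :
    F.NormalizerEmbeds Q' Q := by
  obtain ⟨f, ⟨B, hB⟩, hQ⟩ := h
  obtain rfl := hB.target_eq_normalizerIn hQ hc
  obtain ⟨g, hg, hgf, -⟩ := hB.exists_invOn
  exact ⟨g, hg.mapsOn, hQ.of_leftInvOn (hgf.mono (le_normalizerIn_self hQ.source_le))⟩

open Relation (Join)

/-- Conjugates of `P` that correspond under an isomorphism defined on a group of order greater than
`n` normalizing them both embed, together with their normalizers, into a common conjugate. -/
def JoinsAbove (F : FusionSystem S) (P : Subgroup G) (n : ℕ) : Prop :=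
  ∀ ⦃f Q Q' R⦄, F.IsConj P Q → Q < R → R ≤ normalizerIn S Q → n < Nat.card R → F.MapsOn f R →
    F.MapsOnto f Q Q' → Join F.NormalizerEmbeds Q Q'

namespace JoinsAbove

theorem join_of_embeds (h : F.JoinsAbove P n) (hZ : F.IsConj P Z)
    (hlt : Z < normalizerIn S Z) (hn : n < Nat.card (normalizerIn S Z))
    (hW : F.NormalizerEmbeds Z W) (hW' : F.NormalizerEmbeds Z W') :
    Join F.NormalizerEmbeds W W' := by
  obtain ⟨f, ⟨B, hB⟩, hf⟩ := hW
  obtain ⟨f', ⟨B', hB'⟩, hf'⟩ := hW'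
  obtain ⟨g, hg, hgf, -⟩ := hB.exists_invOn
  exact h (hZ.trans hf.isConj) (hB.target_lt hf hlt) (hB.le_normalizerIn hf hlt.le inf_le_right)
    (hB.card_eq ▸ hn) (hg.comp hB').mapsOn ((hf.of_leftInvOn (hgf.mono hlt.le)).comp hf')

theorem join_trans (h : F.JoinsAbove P n) (hZ : F.IsConj P Z)
    (hlt : Z < normalizerIn S Z) (hn : n < Nat.card (normalizerIn S Z))
    (hQ : Join F.NormalizerEmbeds Q Z) (hQ' : Join F.NormalizerEmbeds Z Q') :
    Join F.NormalizerEmbeds Q Q' := by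
  obtain ⟨W, hQW, hZW⟩ := hQ
  obtain ⟨W', hZW', hQW'⟩ := hQ'
  obtain ⟨V, hWV, hWV'⟩ := h.join_of_embeds hZ hlt hn hZW hZW'
  exact ⟨V, hQW.trans hWV, hQW'.trans hWV'⟩

variable [Fact p.Prime] [Finite S]

theorem join_and_embeds (hS : IsPGroup p S) (h : F.JoinsAbove P (Nat.card R))
    (hQ : F.IsConj P Q) (hQR : Q < R) (hR : R ≤ normalizerIn S Q)
    (hf : F.MapsOn f (R ⊔ normalizerIn S R ⊓ normalizer (Q : Set G))) (hfQ : F.MapsOnto f Q Z) :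
    Join F.NormalizerEmbeds Q Z ∧
      (Nat.card (normalizerIn S Z) ≤ Nat.card R → F.NormalizerEmbeds Q Z) := by
  rcases hR.eq_or_lt with rfl | hlt
  · have hQZ : F.NormalizerEmbeds Q Z := ⟨f, hf.mono le_sup_left, hfQ⟩
    exact ⟨⟨Z, hQZ, .refl hfQ.target_le⟩, fun _ => hQZ⟩
  · have := finite_of_le (inf_le_left : normalizerIn S Q ≤ S)
    have hRM := lt_inf_normalizer (hS.to_le inf_le_left) hlt
    obtain ⟨B, hB⟩ := hf.mono (P' := normalizerIn S Q ⊓ normalizer (R : Set G))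
      (inf_right_comm S _ _ ▸ le_sup_right)
    have hcard : Nat.card R < Nat.card (normalizerIn S Q ⊓ normalizer (R : Set G) : Subgroup G) :=
      card_lt_card_of_lt hRM hB.source_le
    refine ⟨h hQ (hQR.trans hRM) inf_le_left hcard hB.mapsOn hfQ, fun hle => absurd hle ?_⟩
    rw [not_le]
    refine hcard.trans_le (hB.card_eq ▸ card_le_card_of_le (S := S) ?_ inf_le_left)
    exact hB.le_normalizerIn hfQ (hQR.trans hRM).le (inf_le_left.trans inf_le_right)

theorem of_succ (hS : IsPGroup p S) (hP : F.IsSaturatedAbove p P) (h : F.JoinsAbove P (n + 1)) :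
    F.JoinsAbove P n := by
  rintro f Q Q' R hQ hQR hR hn ⟨R', hf⟩ hfQ
  rcases Nat.lt_or_eq_of_le (Nat.succ_le_of_lt hn) with hn | hn
  · exact h hQ hQR hR hn hf.mapsOn hfQ
  rw [Nat.succ_eq_add_one] at hn
  obtain ⟨R₀, Z, -, ⟨u, hu, huR, huQ⟩, u', hu', -, huQ'⟩ :=
    (hP Q hQ R hf.source_le hQR).exists_common_extension hS hf hfQ hQR.le
  have hcR : n + 1 = Nat.card R' := hn.trans hf.card_eq
  obtain ⟨hQZ, hembeds⟩ := join_and_embeds hS (hn ▸ h) hQ hQR hR hu huQ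
  obtain ⟨hQZ', hembeds'⟩ := join_and_embeds hS (hcR ▸ h) (hQ.trans hfQ.isConj)
    (hf.target_lt hfQ hQR) (hf.le_normalizerIn hfQ hQR.le (hR.trans inf_le_right)) hu' huQ'
  rcases le_or_gt (Nat.card (normalizerIn S Z)) (n + 1) with hle | hlt
  · exact ⟨Z, hembeds (hn ▸ hle), hembeds' (hcR ▸ hle)⟩
  · have hZ : Z < normalizerIn S Z := (huR.target_lt huQ hQR).trans_le
      (huR.le_normalizerIn huQ hQR.le (hR.trans inf_le_right))
    exact h.join_trans (hQ.trans huQ.isConj) hZ hlt hQZ (Std.Symm.symm _ _ hQZ')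

end JoinsAbove

theorem IsSaturatedAbove.joinsAbove_zero [Fact p.Prime] [Finite S] (hS : IsPGroup p S)
    (hP : F.IsSaturatedAbove p P) : F.JoinsAbove P 0 :=
  Nat.decreasingInduction (motive := fun n _ => F.JoinsAbove P n)
    (fun _ _ => JoinsAbove.of_succ hS hP)
    (fun _ _ _ _ _ _ hR hn => absurd (card_le_card_of_le (hR.trans inf_le_left) le_rfl)
      (not_le.2 hn))
    (Nat.zero_le (Nat.card S))

section Generation

variable {Δ : Set (Subgroup G)} {r : (G → G) → Subgroup G → Subgroup G → Prop}

theorem ProductOfRestrictions.exists_mapsOnto [Fact p.Prime] [Finite S] (hS : IsPGroup p S)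
    (hΔ : ∀ Q, F.IsConj P Q → Q ∉ Δ)
    (restrict : ∀ {f Q Q' R}, F.IsConj P Q → Q < R → R ≤ normalizerIn S Q → F.MapsOn f R →
      F.MapsOnto f Q Q' → r f Q Q')
    (comp : ∀ {f g Q Q' Q''}, F.IsConj P Q → F.MapsOnto f Q Q' → F.MapsOnto g Q' Q'' →
      r f Q Q' → r g Q' Q'' → r (g ∘ f) Q Q'')
    {X Y : Subgroup G} {φ : X →* Y} (h : F.ProductOfRestrictions Δ φ) :
    ∀ Q (hQ : Q ≤ X), F.IsConj P Q →
      ∃ f Q', F.MapsOnto f Q Q' ∧ r f Q Q' ∧ ∀ x (hx : x ∈ Q), f x = φ ⟨x, hQ hx⟩ := by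
  induction h with
  | restriction hR _ hψ hres =>
    intro Q hQX hQ
    obtain ⟨-, hXR, hφψ⟩ := hres
    obtain ⟨f, _, -, hf, hfψ⟩ := exists_mapsOnto_of_hom hψ
    have hQR := lt_of_le_of_ne (hQX.trans hXR) fun h => hΔ Q hQ (h ▸ hR)
    have := finite_of_le hf.source_le
    obtain ⟨Q', hfQ⟩ := hf.mapsOn.mono hQR.le
    exact ⟨f, Q', hfQ, restrict hQ (lt_inf_normalizer (hS.to_le hf.source_le) hQR)
      (inf_le_inf_right _ hf.source_le) (hf.mapsOn.mono inf_le_left) hfQ, fun x hx =>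
      (hfψ _).symm.trans (hφψ ⟨x, hQX hx⟩)⟩
  | comp _ _ ih ih' =>
    rename_i φ ψ _ _
    intro Q hQX hQ
    obtain ⟨f, Q', hf, hr, hfφ⟩ := ih Q hQX hQ
    have hQ' := hf.target_le_of_mapsTo fun x hx => (hfφ x hx).symm ▸ (φ ⟨x, hQX hx⟩).2
    obtain ⟨g, Q'', hg, hr', hgψ⟩ := ih' Q' hQ' (hQ.trans hf.isConj)
    refine ⟨g ∘ f, Q'', hf.comp hg, comp hQ hf hg hr hr', fun x hx => ?_⟩
    have hfx : (⟨f x, hQ' (hf.apply_mem hx)⟩ : _) = φ ⟨x, hQX hx⟩ := Subtype.ext (hfφ x hx)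
    exact (hgψ _ (hf.apply_mem hx)).trans (congrArg (fun y => (ψ y : G)) hfx)

/-- Since `P` and its conjugates lie outside `Δ`, the subgroups in `Δ` that contain a conjugate `Q`
meet `N_S(Q)` in more than `Q`. -/
theorem IsGeneratedBy.induction_on [Fact p.Prime] [Finite S] (hS : IsPGroup p S)
    (hgen : F.IsGeneratedBy Δ) (hΔ : ∀ Q, F.IsConj P Q → Q ∉ Δ)
    (congr : ∀ {f g} {Q Q' : Subgroup G}, Set.EqOn g f Q → r f Q Q' → r g Q Q')
    (restrict : ∀ {f Q Q' R}, F.IsConj P Q → Q < R → R ≤ normalizerIn S Q → F.MapsOn f R →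
      F.MapsOnto f Q Q' → r f Q Q')
    (comp : ∀ {f g Q Q' Q''}, F.IsConj P Q → F.MapsOnto f Q Q' → F.MapsOnto g Q' Q'' →
      r f Q Q' → r g Q' Q'' → r (g ∘ f) Q Q'')
    (hQ : F.IsConj P Q) (hf : F.MapsOnto f Q Q') : r f Q Q' := by
  obtain ⟨e, he, hef⟩ := id hf
  obtain ⟨g, Q₁, hg, hr, hge⟩ :=
    (hgen _ _ _ he.1).exists_mapsOnto hS hΔ restrict comp Q le_rfl hQ
  have hfg : Set.EqOn f g Q := fun x hx => (hef ⟨x, hx⟩).symm.trans (hge x hx).symm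
  exact congr hfg ((hg.congr hfg).target_unique hf ▸ hr)

theorem IsSaturatedAbove.normalizerEmbeds [Fact p.Prime] [Finite S] (hS : IsPGroup p S)
    (hgen : F.IsGeneratedBy Δ) (hΔ : ∀ Q, F.IsConj P Q → Q ∉ Δ) (hP : F.IsSaturatedAbove p P)
    (hPS : P ≠ S)
    (hmax : ∀ W, F.IsConj P W → Nat.card (normalizerIn S W) ≤ Nat.card (normalizerIn S P))
    (hQ : F.IsConj P Q) : F.NormalizerEmbeds Q P := by
  obtain ⟨f, hf⟩ := hQ.symm.exists_mapsOnto
  have hjoins := hP.joinsAbove_zero hS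
  have hlt {Z : Subgroup G} (hZ : F.IsConj P Z) : Z < normalizerIn S Z := by
    obtain ⟨f, hf⟩ := hZ.exists_mapsOnto
    have hZS : Z < S := hf.target_le.lt_of_ne fun h => hPS <| eq_of_le_of_card_ge hf.source_le
      (hf.card_eq.trans (congrArg (fun H : Subgroup G => Nat.card H) h)).ge
    exact lt_inf_normalizer hS hZS
  obtain ⟨W, hQW, hPW⟩ : Join F.NormalizerEmbeds Q P :=
    hgen.induction_on hS hΔ (r := fun _ => Join F.NormalizerEmbeds) (fun _ h => h)
      (fun hQ hQR hR hf hfQ => hjoins hQ hQR hR (card_pos_of_le hf.source_le) hf hfQ)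
      (fun hQ hf _ h h' => hjoins.join_trans (hQ.trans hf.isConj) (hlt (hQ.trans hf.isConj))
        (card_pos_of_le inf_le_left) h h') hQ hf
  exact hQW.trans (hPW.symm_of_card_le (hmax W hPW.isConj))

end Generation

end FusionSystem

end Confluence

section Core

variable {G : Type*} [Group G] {S T : Subgroup G} {p : ℕ}

open scoped Pointwise in
theorem lt_sup_inf_normalizer [Fact p.Prime] {P K : Subgroup G} (hP : P ≤ normalizer (K : Set G))
    (hK : ¬K ≤ P) (hp : IsPGroup p (P ⊔ K : Subgroup G)) [Finite (P ⊔ K : Subgroup G)] :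
    P < P ⊔ K ⊓ normalizer (P : Set G) := by
  obtain ⟨m, hm, hmP⟩ := SetLike.exists_of_lt (lt_inf_normalizer hp (left_lt_sup.2 hK))
  refine lt_of_le_of_ne le_sup_left fun h => hmP ?_
  have hmK : m ∈ (P : Set G) * K := by
    rw [← coe_mul_of_left_le_normalizer_right P K hP]
    exact hm.1
  obtain ⟨a, ha, k, hk, rfl⟩ := hmK
  have hkn : k ∈ normalizer (P : Set G) := by
    simpa only [inv_mul_cancel_left] using mul_mem (inv_mem (le_normalizer ha)) hm.2
  exact P.mul_mem ha (h ▸ mem_sup_right ⟨hk, hkn⟩)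

namespace FusionSystem

variable {F : FusionSystem S} {f g h θ : G → G} {P P' Q Q' Q'' R R' K Z : Subgroup G} {y : G}
  {n : ℕ}

theorem MapsOnto.congr_normalizerMonoidHom (h : F.MapsOnto θ R R') {e : P ≃* P'}
    (he : ∀ x : P, (e x : G) = θ x) (hP : P ≤ R) (hy : y ∈ R) (hn : y ∈ normalizer (P : Set G))
    (hn' : θ y ∈ normalizer (P' : Set G)) :
    MulAut.congr e (P.normalizerMonoidHom ⟨y, hn⟩) = P'.normalizerMonoidHom ⟨θ y, hn'⟩ := by
  refine MulEquiv.ext fun z => Subtype.ext ?_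
  obtain ⟨x, rfl⟩ := e.surjective z
  change (e (P.normalizerMonoidHom ⟨y, hn⟩ (e.symm (e x))) : G) = θ y * e x * (θ y)⁻¹
  rw [e.symm_apply_apply, he, he, ← h.map_conj hy (hP x.2)]
  rfl

theorem MapsOnto.apply_mem_coreIn (h : F.MapsOnto θ R R') (h' : F.MapsOnto θ P P')
    {E : FusionSystem T} {hPT : P ≤ T} {hPT' : P' ≤ T} {e : P ≃* P'}
    (he : ∀ x : P, (e x : G) = θ x)
    (hmap : (E.aut P hPT).map (MulAut.congr e).toMonoidHom = E.aut P' hPT') (hP : P ≤ R)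
    (hy : y ∈ R) (hyT : θ y ∈ T) (hyc : y ∈ E.coreIn p P hPT) : θ y ∈ E.coreIn p P' hPT' := by
  obtain ⟨-, a, ha, hn, rfl⟩ := mem_coreIn_iff.1 hyc
  have hn' := h.apply_mem_normalizer h' hP hy hn
  exact mem_coreIn_iff.2 ⟨hyT, _, hmap ▸ map_pCore_le _ _ ⟨_, ha, rfl⟩, hn',
    (h.congr_normalizerMonoidHom he hP hy hn hn').symm⟩

theorem MapsOnto.mem_coreIn_iff (h : F.MapsOnto θ R R') (h' : F.MapsOnto θ P P') (hP : P ≤ R)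
    (hPS : P ≤ S) (hPS' : P' ≤ S) (hy : y ∈ R) :
    θ y ∈ F.coreIn p P' hPS' ↔ y ∈ F.coreIn p P hPS := by
  have key {f : G → G} {A A' B B' : Subgroup G} {hA : A ≤ S} {hA' : A' ≤ S} {x : G}
      (h : F.MapsOnto f B B') (h' : F.MapsOnto f A A') (hAB : A ≤ B) (hx : x ∈ B)
      (hxA : x ∈ F.coreIn p A hA) : f x ∈ F.coreIn p A' hA' := by
    obtain ⟨e, he, hef⟩ := id h'
    exact h.apply_mem_coreIn h' hef (map_aut he hA hA') hAB hx (h.target_le (h.apply_mem hx)) hxA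
  refine ⟨fun hc => ?_, key h h' hP hy⟩
  obtain ⟨g, hg, hgθ, -⟩ := h.exists_invOn
  exact hgθ hy ▸ key hg (h'.of_leftInvOn (hgθ.mono hP)) (h.target_mono h' hP) (h.apply_mem hy) hc

section CoreIn

variable {hP : P ≤ S} {hQ : Q ≤ S}

theorem coreIn_le : F.coreIn p P hP ≤ S :=
  inf_le_left

theorem le_coreIn (hS : IsPGroup p S) : P ≤ F.coreIn p P hP := by
  intro y hy
  refine FusionSystem.mem_coreIn_iff.2 ⟨hP hy, _, le_pCore (N := autS P P)
    ((autS_mono hP P).trans (autS_le_aut hP)) (le_normalizer_iff.2 fun a _ b hb => ?_)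
    (isPGroup_autS (hS.to_le hP) P) ⟨_, mem_subgroupOf.2 hy, rfl⟩, le_normalizer hy, rfl⟩
  obtain ⟨s, hs, hbs⟩ := mem_autS_iff.1 hb
  refine mem_autS_iff.2 ⟨a ⟨s, hs.1⟩, ⟨(a _).2, le_normalizer (a _).2⟩, fun x => ?_⟩
  have hbx : b (a⁻¹ x) = ⟨s, hs.1⟩ * a⁻¹ x * ⟨s, hs.1⟩⁻¹ := Subtype.ext (hbs _)
  rw [MulAut.mul_apply, MulAut.mul_apply, hbx, map_mul, map_mul, map_inv, MulAut.apply_inv_self]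
  rfl

theorem MapsOnto.coreIn (h : F.MapsOnto f (normalizerIn S P) (normalizerIn S Q))
    (h' : F.MapsOnto f P Q) : F.MapsOnto f (F.coreIn p P hP) (F.coreIn p Q hQ) := by
  have hPN := le_normalizerIn_self hP
  refine (h.mapsOn.mono coreIn_le_normalizerIn).mapsOnto (Set.Subset.antisymm ?_ fun z hz => ?_)
  · rintro _ ⟨y, hy, rfl⟩
    exact (h.mem_coreIn_iff h' hPN hP hQ (coreIn_le_normalizerIn hy)).2 hy
  · obtain ⟨y, hy, rfl⟩ := h.bijOn.surjOn (coreIn_le_normalizerIn hz)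
    exact ⟨y, (h.mem_coreIn_iff h' hPN hP hQ hy).1 hz, rfl⟩

theorem normalizerIn_le_normalizer_coreIn :
    normalizerIn S P ≤ normalizer (F.coreIn p P hP : Set G) := by
  intro s hs
  have h : F.MapsOnto (MulAut.conj s) (normalizerIn S P) (normalizerIn S P) :=
    mapsOnto_conj inf_le_left ⟨hs.1, le_normalizer hs⟩
  exact mem_normalizer_iff_conj_image_eq.2
    ((h.coreIn (hP := hP) (hQ := hP) (mapsOnto_conj hP hs)).bijOn.image_eq)

end CoreIn

/-- Some automorphism of `K` in `F` agrees with `f` on `P`. -/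
def ExtendsTo (F : FusionSystem S) (K P : Subgroup G) (f : G → G) : Prop :=
  ∃ g, F.MapsOnto g K K ∧ Set.EqOn g f P

/-- The isomorphism `f : Q → Q'` becomes an automorphism of `P` that extends to `K` whenever `Q` and
`Q'` are identified with `P` along isomorphisms of `F` that extend to `N_S(Q)` and `N_S(Q')`. -/
def TransportExtendsTo (F : FusionSystem S) (K P : Subgroup G) (f : G → G) (Q Q' : Subgroup G) :
    Prop :=
  ∀ ⦃h h' w⦄, F.MapsOn h (normalizerIn S Q) → F.MapsOnto h Q P → F.MapsOn h' (normalizerIn S Q') →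
    F.MapsOnto h' Q' P → (∀ x ∈ Q, w (h x) = h' (f x)) → F.ExtendsTo K P w

namespace TransportExtendsTo

theorem congr (h : F.TransportExtendsTo K P f Q Q') (hfg : Set.EqOn g f Q) :
    F.TransportExtendsTo K P g Q Q' :=
  fun _ _ _ hN hQ hN' hQ' hw => h hN hQ hN' hQ' fun x hx => (hw x hx).trans (by rw [hfg hx])

theorem comp (hf : F.MapsOnto f Q Q') (h : F.TransportExtendsTo K P f Q Q')
    (h' : F.TransportExtendsTo K P g Q' Q'') (hQ' : F.NormalizerEmbeds Q' P) :
    F.TransportExtendsTo K P (g ∘ f) Q Q'' := by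
  obtain ⟨k, hkN, hk⟩ := hQ'
  intro u u'' w huN hu huN'' hu'' hw
  obtain ⟨i, -, hiu, -⟩ := hu.exists_invOn
  obtain ⟨j, -, hjk, -⟩ := hk.exists_invOn
  obtain ⟨a, ha, hau⟩ := h (w := k ∘ f ∘ i) huN hu hkN hk fun x hx =>
    congrArg (fun z => k (f z)) (hiu hx)
  obtain ⟨b, hb, hbk⟩ := h' (w := u'' ∘ g ∘ j) hkN hk huN'' hu'' fun y hy =>
    congrArg (fun z => u'' (g z)) (hjk hy)
  refine ⟨b ∘ a, ha.comp hb, fun z hz => ?_⟩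
  obtain ⟨x, hx, rfl⟩ := hu.bijOn.surjOn hz
  have hfx := hf.apply_mem hx
  rw [hw x hx, Function.comp_apply, hau hz, Function.comp_apply, Function.comp_apply, hiu hx,
    hbk (hk.apply_mem hfx), Function.comp_apply, Function.comp_apply, hjk hfx]
  rfl

theorem of_leftInvOn (hPK : P ≤ K) (hf : F.MapsOnto f Q Q') (h : F.TransportExtendsTo K P f Q Q')
    (hg : Set.LeftInvOn g f Q) : F.TransportExtendsTo K P g Q' Q := by
  intro u u' w huN hu huN' hu' hw
  obtain ⟨i, -, hiu, -⟩ := hu'.exists_invOn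
  obtain ⟨a, ha, hau⟩ := h (w := u ∘ f ∘ i) huN' hu' huN hu fun x hx =>
    congrArg (fun z => u (f z)) (hiu hx)
  obtain ⟨b, hb, hba, -⟩ := ha.exists_invOn
  refine ⟨b, hb, fun z hz => ?_⟩
  obtain ⟨y, hy, rfl⟩ := hu.bijOn.surjOn hz
  obtain ⟨x, hx, rfl⟩ := hf.bijOn.surjOn hy
  have hax : a (u' x) = u (f x) := by
    rw [hau (hu'.apply_mem hx), Function.comp_apply, Function.comp_apply, hiu hx]
  rw [hw _ hy, hg hx, ← hax, hba (hPK (hu'.apply_mem hx))]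

theorem extendsTo (hP : P ≤ S) (h : F.TransportExtendsTo K P f P P) : F.ExtendsTo K P f :=
  have hid := mapsOnto_id (F := F) (P := normalizerIn S P) inf_le_left
  h hid.mapsOn (mapsOnto_id hP) hid.mapsOn (mapsOnto_id hP) fun _ _ => rfl

end TransportExtendsTo

/-- Automorphisms of `P` in `F` that are defined on a group of order greater than `n` normalizing
`P` extend to `K`. -/
def ExtendsToAbove (F : FusionSystem S) (K P : Subgroup G) (n : ℕ) : Prop :=
  ∀ ⦃f R⦄, P < R → R ≤ normalizerIn S P → n < Nat.card R → F.MapsOn f R → F.MapsOnto f P P →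
    F.ExtendsTo K P f

theorem ExtendsToAbove.transportExtendsTo (h : F.ExtendsToAbove K P n) (hQR : Q < R)
    (hR : R ≤ normalizerIn S Q) (hn : n < Nat.card R) (hf : F.MapsOn f R)
    (hfQ : F.MapsOnto f Q Q') : F.TransportExtendsTo K P f Q Q' := by
  intro u u' w huN hu huN' hu' hw
  obtain ⟨R', hf⟩ := hf
  obtain ⟨B, hB⟩ := huN.mono hR
  obtain ⟨B', hB'⟩ := huN'.mono (hf.le_normalizerIn hfQ hQR.le (hR.trans inf_le_right))
  obtain ⟨i, hi, hiu, -⟩ := hB.exists_invOn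
  obtain ⟨a, ha, hau⟩ := h (hB.target_lt hu hQR)
    (hB.le_normalizerIn hu hQR.le (hR.trans inf_le_right)) (hB.card_eq ▸ hn)
    (hi.comp (hf.comp hB')).mapsOn ((hu.of_leftInvOn (hiu.mono hQR.le)).comp (hfQ.comp hu'))
  refine ⟨a, ha, fun z hz => ?_⟩
  obtain ⟨x, hx, rfl⟩ := hu.bijOn.surjOn hz
  rw [hau hz, hw x hx, Function.comp_apply, Function.comp_apply, hiu (hQR.le hx)]

section

variable {hP : P ≤ S} [Finite S]

theorem MapsOnto.extendsTo_coreIn_of_le (hf : F.MapsOnto f R R') (hfP : F.MapsOnto f P P)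
    (hPR : P ≤ R) (hKR : F.coreIn p P hP ≤ R) : F.ExtendsTo (F.coreIn p P hP) P f := by
  obtain ⟨K', hfK⟩ := hf.mapsOn.mono hKR
  have hK' : K' ≤ F.coreIn p P hP := hfK.target_le_of_mapsTo fun y hy =>
    (hf.mem_coreIn_iff hfP hPR hP hP (hKR hy)).2 hy
  have := finite_of_le (F.coreIn_le (p := p) (hP := hP))
  obtain rfl := eq_of_le_of_card_ge hK' hfK.card_eq.le
  exact ⟨f, hfK, fun _ _ => rfl⟩

variable [Fact p.Prime]

theorem MapsOn.not_coreIn_le {hZ : Z ≤ S} (hS : IsPGroup p S)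
    (hf : F.MapsOn f (R ⊔ normalizerIn S R ⊓ normalizer (P : Set G))) (hfR : F.MapsOnto f R R')
    (hfP : F.MapsOnto f P Z) (hPR : P ≤ R) (hR : R ≤ normalizerIn S P)
    (hKR : ¬F.coreIn p P hP ≤ R) : ¬F.coreIn p Z hZ ≤ R' := by
  have hRK : R ⊔ F.coreIn p P hP ≤ S := sup_le hfR.source_le coreIn_le
  have := finite_of_le hRK
  have hlt := lt_sup_inf_normalizer (hR.trans normalizerIn_le_normalizer_coreIn) hKR (hS.to_le hRK)
  obtain ⟨k, ⟨hkK, hkR⟩, hk⟩ := SetLike.not_le_iff_exists.1 (left_lt_sup.1 hlt)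
  have hkn := coreIn_le_normalizerIn hkK
  obtain ⟨B, hB⟩ := hf
  have hkB : k ∈ R ⊔ normalizerIn S R ⊓ normalizer (P : Set G) :=
    mem_sup_right ⟨⟨hkn.1, hkR⟩, hkn.2⟩
  intro hle
  have hfk := (hB.mem_coreIn_iff hfP (hPR.trans le_sup_left) hP hZ hkB).2 hkK
  exact hk ((hB.mem_iff hfR le_sup_left hkB).1 (hle hfk))

namespace ExtendsToAbove

theorem transportExtendsTo_of_lt (hS : IsPGroup p S) (h : F.ExtendsToAbove K P (Nat.card R))
    (hPR : Q < R) (hR : R < normalizerIn S Q)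
    (hf : F.MapsOn f (R ⊔ normalizerIn S R ⊓ normalizer (Q : Set G))) (hfQ : F.MapsOnto f Q Q') :
    F.TransportExtendsTo K P f Q Q' := by
  have := finite_of_le (inf_le_left : normalizerIn S Q ≤ S)
  have hRM := lt_inf_normalizer (hS.to_le inf_le_left) hR
  exact h.transportExtendsTo (hPR.trans hRM) inf_le_left
    (card_lt_card_of_lt hRM (inf_le_left.trans inf_le_left))
    (hf.mono (inf_right_comm S _ _ ▸ le_sup_right)) hfQ

theorem transportExtendsTo_of_wellPlaced (hS : IsPGroup p S) (hw : F.WellPlaced p R Z)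
    {hZ : Z ≤ S} (hZR : Z < R) (hR : R ≤ normalizerIn S Z) (hKR : ¬F.coreIn p Z hZ ≤ R)
    (hf : F.MapsOnto f R R) (hfZ : F.MapsOnto f Z Z) (h : F.ExtendsToAbove K P (Nat.card R)) :
    F.TransportExtendsTo K P f Z Z := by
  obtain ⟨v, hv, -, hvf⟩ := hw.exists_extension_coreIn (hX := hZ) hS hf hfZ hZR.le
  have hRK : R ⊔ F.coreIn p Z hZ ≤ S := sup_le hf.source_le coreIn_le
  have := finite_of_le hRK
  have hlt := lt_sup_inf_normalizer (hR.trans normalizerIn_le_normalizer_coreIn) hKR (hS.to_le hRK)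
  exact (h.transportExtendsTo (hZR.trans hlt)
    (sup_le hR (inf_le_left.trans coreIn_le_normalizerIn)) (card_lt_card_of_lt hlt hv.source_le) hv
    (hfZ.congr hvf)).congr hvf.symm

theorem of_succ (hS : IsPGroup p S) (hP' : F.IsSaturatedAbove p P)
    (hB : ∀ Q, F.IsConj P Q → F.NormalizerEmbeds Q P)
    (h : F.ExtendsToAbove (F.coreIn p P hP) P (n + 1)) :
    F.ExtendsToAbove (F.coreIn p P hP) P n := by
  rintro f R hPR hR hn ⟨R', hf⟩ hfP
  rcases Nat.lt_or_eq_of_le (Nat.succ_le_of_lt hn) with hn | hn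
  · exact h hPR hR hn hf.mapsOn hfP
  rw [Nat.succ_eq_add_one] at hn
  by_cases hKR : F.coreIn p P hP ≤ R
  · exact hf.extendsTo_coreIn_of_le hfP hPR.le hKR
  obtain ⟨R₀, Z, hw, ⟨u, hu, huR, huP⟩, u', hu', huR', huP'⟩ :=
    (hP' P hfP.isConj R hf.source_le hPR).exists_common_extension hS hf hfP hPR.le
  have hRN : R < normalizerIn S P :=
    hR.lt_of_ne fun heq => hKR (coreIn_le_normalizerIn.trans heq.ge)
  have hRN' : R' < normalizerIn S P :=
    (hf.le_normalizerIn hfP hPR.le (hR.trans inf_le_right)).lt_of_ne fun heq =>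
      (card_lt_card_of_lt hRN inf_le_left).ne (hf.card_eq.trans (by rw [heq]))
  obtain ⟨i, hi, hiu, -⟩ := huR.exists_invOn
  obtain ⟨j, -, hju, -⟩ := huR'.exists_invOn
  have hPR' : P < R' := hf.target_lt hfP hPR
  have hiP := huP.of_leftInvOn (hiu.mono hPR.le)
  have hZ := hB Z huP.isConj
  have hru := transportExtendsTo_of_lt hS (hn ▸ h) hPR hRN hu huP
  have hru' := transportExtendsTo_of_lt hS (hn.trans hf.card_eq ▸ h) hPR' hRN' hu' huP'
  have hrj := hru'.of_leftInvOn (le_coreIn hS) huP' (hju.mono hPR'.le)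
  have hrv : F.TransportExtendsTo (F.coreIn p P hP) P (u' ∘ f ∘ i) Z Z :=
    transportExtendsTo_of_wellPlaced hS hw (huR.target_lt huP hPR)
      (huR.le_normalizerIn huP hPR.le (hR.trans inf_le_right))
      (hu.not_coreIn_le hS huR huP hPR.le hR hKR (hZ := huP.target_le))
      (hi.comp (hf.comp huR')) (hiP.comp (hfP.comp huP')) (hn.trans huR.card_eq ▸ h)
  refine (((hru.comp huP hrv hZ).comp (huP.comp (hiP.comp (hfP.comp huP'))) hrj hZ).congr
    fun x hx => ?_).extendsTo hP
  simp only [Function.comp_apply]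
  rw [hiu (hPR.le hx), hju (hPR'.le (hfP.apply_mem hx))]

end ExtendsToAbove

theorem IsSaturatedAbove.extendsToAbove_zero (hS : IsPGroup p S) (hP' : F.IsSaturatedAbove p P)
    (hB : ∀ Q, F.IsConj P Q → F.NormalizerEmbeds Q P) :
    F.ExtendsToAbove (F.coreIn p P hP) P 0 :=
  Nat.decreasingInduction (motive := fun n _ => F.ExtendsToAbove (F.coreIn p P hP) P n)
    (fun _ _ => ExtendsToAbove.of_succ hS hP' hB)
    (fun _ _ _ hR hn => absurd (card_le_card_of_le (hR.trans inf_le_left) le_rfl) (not_le.2 hn))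
    (Nat.zero_le (Nat.card S))

theorem IsSaturatedAbove.extendsTo_coreIn {Δ : Set (Subgroup G)} (hS : IsPGroup p S)
    (hgen : F.IsGeneratedBy Δ) (hΔ : ∀ Q, F.IsConj P Q → Q ∉ Δ) (hP' : F.IsSaturatedAbove p P)
    (hB : ∀ Q, F.IsConj P Q → F.NormalizerEmbeds Q P) (hf : F.MapsOnto f P P) :
    F.ExtendsTo (F.coreIn p P hP) P f :=
  (hgen.induction_on hS hΔ (r := F.TransportExtendsTo (F.coreIn p P hP) P)
    (fun hfg h => h.congr hfg)
    (fun _ hQR hR hf hfQ => (hP'.extendsToAbove_zero hS hB).transportExtendsTo hQR hR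
      (card_pos_of_le hf.source_le) hf hfQ)
    (fun hQ hf _ h h' => h.comp hf h' (hB _ (hQ.trans hf.isConj))) hf.isConj hf).extendsTo hP

end

end FusionSystem

end Core

section Saturation

variable {G : Type*} [Group G] {S : Subgroup G} {p : ℕ}

namespace FusionSystem

variable {F : FusionSystem S} {f : G → G} {P Q R Z K N D : Subgroup G}

section

variable {hR : R ≤ S} {hZ : Z ≤ R} {B C : Subgroup (MulAut Z)}

theorem autS_inf_autStab_le : autS S R ⊓ F.autStab hR hZ ≤ F.autOver hR hZ (autS S Z) := by
  rintro a ⟨haS, ha, c, -, hac⟩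
  obtain ⟨s, hs, has⟩ := mem_autS_iff.1 haS
  have hcs (z : Z) : (c z : G) = s * z * s⁻¹ :=
    (congrArg Subtype.val (hac z)).symm.trans (has (inclusion hZ z))
  have hsZ : s ∈ normalizer (Z : Set G) := by
    refine mem_normalizer_iff.2 fun z => ⟨fun hz => hcs ⟨z, hz⟩ ▸ (c ⟨z, hz⟩).2, fun hz => ?_⟩
    obtain ⟨y, hy⟩ := c.surjective ⟨s * z * s⁻¹, hz⟩
    have hyz : s * y * s⁻¹ = s * z * s⁻¹ := (hcs y).symm.trans (congrArg Subtype.val hy)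
    exact mul_left_cancel (mul_right_cancel hyz) ▸ y.2
  exact ⟨ha, c, mem_autS_iff.2 ⟨s, ⟨hs.1, hsZ⟩, hcs⟩, hac⟩

theorem exists_iso_extension (hext : ∀ f, F.MapsOnto f Z Z → F.ExtendsTo R Z f) {b : Z ≃* Z}
    (hb : b ∈ F.Iso Z Z) : ∃ a ∈ F.Iso R R, ∀ z, a (inclusion hZ z) = inclusion hZ (b z) := by
  obtain ⟨f, hf, hbf⟩ := exists_mapsOnto hb
  obtain ⟨g, ⟨a, ha, hag⟩, hgf⟩ := hext f hf
  exact ⟨a, ha, fun z => Subtype.ext ((hag _).trans ((hgf z.2).trans (hbf z).symm))⟩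

theorem le_of_autOver_le (hext : ∀ f, F.MapsOnto f Z Z → F.ExtendsTo R Z f)
    (hB : B ≤ F.aut Z (hZ.trans hR)) (h : F.autOver hR hZ B ≤ F.autOver hR hZ C) : B ≤ C := by
  intro b hb
  obtain ⟨a, ha, hab⟩ := exists_iso_extension (hZ := hZ) hext (hB hb)
  obtain ⟨-, c, hc, hac⟩ := h ⟨ha, b, hb, hab⟩
  have hbc : b = c := MulEquiv.ext fun z => inclusion_injective hZ ((hab z).symm.trans (hac z))
  exact hbc ▸ hc

end

theorem MapsOnto.autS_target_le (h : F.MapsOnto f N D) {e : Q ≃* P}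
    (he : ∀ x : Q, (e x : G) = f x) (hQ : Q ≤ N) (hn : N ≤ normalizer (Q : Set G)) :
    autS D P ≤ (autS N Q).map (MulAut.congr e).toMonoidHom := by
  rintro _ ⟨⟨d, hdn⟩, hd, rfl⟩
  obtain ⟨y, hy, rfl⟩ := h.bijOn.surjOn (mem_subgroupOf.1 hd)
  exact ⟨_, ⟨⟨y, hn hy⟩, mem_subgroupOf.2 hy, rfl⟩,
    h.congr_normalizerMonoidHom he hQ hy (hn hy) hdn⟩

variable [Fact p.Prime] [Finite S]

namespace WellPlaced

theorem autOver_le_sup {hK : K ≤ S} {hP : P ≤ K} {C : Subgroup (MulAut P)}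
    (hw : F.WellPlaced p K P) (hC : IsPGroup p C) (hSC : autS S P ≤ C)
    (hCF : C ≤ F.aut P (hP.trans hK)) :
    F.autOver hK hP C ≤ autS S K ⊓ F.autStab hK hP ⊔ F.autOver hK hP ⊥ := by
  obtain ⟨_, _, -, hsyl⟩ := hw
  exact FusionSystem.autOver_le_sup
    (hsyl.mono (autS_inf_autStab_le.trans (autOver_mono hSC)) (autOver_mono hCF))
    (autOver_mono hCF) hC le_rfl le_normalizer

theorem fullyAutomized (hS : IsPGroup p S) (hw : F.WellPlaced p K P)
    (hext : ∀ f, F.MapsOnto f P P → F.ExtendsTo K P f) : F.FullyAutomized p P := by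
  obtain ⟨hK, hP, -, -⟩ := id hw
  obtain ⟨B, hSB, hB⟩ :=
    exists_le_isSylowIn (autS_le_aut (F := F) (hP.trans hK)) (isPGroup_autS hS P)
  have hBS : B ≤ autS S P := le_of_autOver_le (hZ := hP) hext hB.le
    ((hw.autOver_le_sup (hK := hK) hB.isPGroup hSB hB.le).trans
      (sup_le autS_inf_autStab_le (autOver_mono bot_le)))
  exact ⟨hP.trans hK, isSylowIn_iff_exists_sylow.1 (le_antisymm hBS hSB ▸ hB)⟩

theorem receptive (hS : IsPGroup p S) (hw : F.WellPlaced p K P)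
    (hPK : normalizerIn S P ≤ normalizer (K : Set G))
    (hext : ∀ f, F.MapsOnto f P P → F.ExtendsTo K P f)
    (hB : ∀ Q, F.IsConj P Q → F.NormalizerEmbeds Q P) : F.Receptive P := by
  obtain ⟨hK, hP, -, -⟩ := id hw
  refine receptive_of_forall (hP.trans hK) fun Q e he => ?_
  have hQ := source_le_extender (e := e) (F.source_le he.1) (hP.trans hK)
  obtain ⟨θ, hθN, hθ⟩ := hB Q ⟨e.symm, he.2, he.1⟩
  obtain ⟨e', he', heθ⟩ := id hθ
  obtain ⟨D, hD⟩ := hθN.mono (extender_le_normalizerIn (e := e))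
  have hDP : D ≤ normalizerIn S P :=
    hD.le_normalizerIn hθ hQ (extender_le_normalizerIn.trans inf_le_right)
  obtain ⟨a, ha, hab⟩ := exists_iso_extension (b := e'.symm.trans e) (hZ := hP) hext
    ⟨F.comp_mem he'.2 he.1, F.comp_mem he.2 he'.1⟩
  have hDS : (autS D P).map (MulAut.congr (e'.symm.trans e)).toMonoidHom ≤ autS S P := by
    have hDe := hD.autS_target_le heθ hQ (extender_le_normalizerIn.trans inf_le_right)
    refine (map_mono hDe).trans (le_trans ?_ (map_autS_extender_le (e := e)))
    rintro _ ⟨_, ⟨c, hc, rfl⟩, rfl⟩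
    refine ⟨c, hc, MulEquiv.ext fun x => ?_⟩
    simp
  obtain ⟨h, hh, -, hhe⟩ := hw.exists_extension_of_le_sup (hX := hP) hS ha hab
    (le_inf (hDP.trans inf_le_left) (hDP.trans hPK)) (hDP.trans inf_le_right) hDS
    (hw.autOver_le_sup (hK := hK) (isPGroup_autS hS P) le_rfl (autS_le_aut _))
  obtain ⟨B, hB⟩ := hh.mono (le_sup_right : D ≤ K ⊔ D)
  refine ⟨h ∘ θ, (hD.comp hB).mapsOn, fun x => ?_⟩
  rw [Function.comp_apply, ← heθ, hhe, MulEquiv.trans_apply, e'.symm_apply_apply]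

end WellPlaced

theorem isSaturatedAt_of_coreIn_not_le {Δ : Set (Subgroup G)} {hP : P ≤ S} (hS : IsPGroup p S)
    (hgen : F.IsGeneratedBy Δ) (hΔ : ∀ Q, F.IsConj P Q → Q ∉ Δ) (hsat : F.IsSaturatedAbove p P)
    (hmax : ∀ Q, F.IsConj P Q → Nat.card (normalizerIn S Q) ≤ Nat.card (normalizerIn S P))
    (hK : ¬F.coreIn p P hP ≤ P) : F.IsSaturatedAt p P := by
  have hPK : P < F.coreIn p P hP := (le_coreIn hS).lt_of_not_ge hK
  obtain ⟨f, K, Z, hf, hfP, hw⟩ :=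
    (hsat P (mapsOnto_id hP).isConj _ coreIn_le hPK).exists_wellPlaced hS hPK.le
  obtain ⟨g, hg, hgK, hgP⟩ := hw.exists_extension_normalizerIn hS hf hfP hPK.le
  obtain ⟨B, hB⟩ := hg.mono (P' := normalizerIn S P) (le_sup_of_le_right
    (le_inf (le_inf inf_le_left normalizerIn_le_normalizer_coreIn) inf_le_right))
  have hZ := hgP.isConj
  obtain rfl := hB.target_eq_normalizerIn hgP (hmax Z hZ)
  obtain rfl := hgK.target_unique (hB.coreIn hgP (hQ := hgP.target_le))
  have hsatZ : F.IsSaturatedAbove p Z := fun Q hQ => hsat Q (hZ.trans hQ)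
  have hΔZ (Q) (hQ : F.IsConj Z Q) : Q ∉ Δ := hΔ Q (hZ.trans hQ)
  have hembeds (Q) (hQ : F.IsConj Z Q) : F.NormalizerEmbeds Q Z :=
    hsatZ.normalizerEmbeds hS hgen hΔZ ((hgK.target_lt hgP hPK).trans_le hgK.target_le).ne
      (fun W hW => hB.card_eq ▸ hmax W (hZ.trans hW)) hQ
  have hext (f) (hf : F.MapsOnto f Z Z) := hsatZ.extendsTo_coreIn (hP := hgP.target_le) hS hgen hΔZ
    hembeds hf
  exact ⟨Z, hZ, hw.fullyAutomized hS hext,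
    hw.receptive hS normalizerIn_le_normalizer_coreIn hext hembeds⟩

end FusionSystem

end Saturation

section Invariant

variable {G : Type*} [Group G] {S T : Subgroup G} {p : ℕ}

namespace FusionSystem

variable {F : FusionSystem S} {E : FusionSystem T} {f : G → G} {P P' Q R R' M Z : Subgroup G}
  {x y : G}

theorem IsSubsystem.mapsOnto (h : E.IsSubsystem F) (hf : E.MapsOnto f P Q) : F.MapsOnto f P Q :=
  have ⟨e, he, hef⟩ := hf
  ⟨e, ⟨h.2 _ _ he.1, h.2 _ _ he.2⟩, hef⟩

namespace StronglyClosed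

theorem apply_mem_iff (h : F.StronglyClosed T) (hf : F.MapsOnto f P Q) (hx : x ∈ P) :
    f x ∈ T ↔ x ∈ T := by
  have key {f : G → G} {P Q : Subgroup G} (hf : F.MapsOnto f P Q) {x : G} (hx : x ∈ P)
      (hxT : x ∈ T) : f x ∈ T := by
    obtain ⟨e, he, hef⟩ := hf
    exact hef ⟨x, hx⟩ ▸ h.2 _ _ _ he.1 ⟨x, hx⟩ hxT
  obtain ⟨g, hg, hgf, -⟩ := hf.exists_invOn
  exact ⟨fun hfx => hgf hx ▸ key hg (hf.apply_mem hx) hfx, key hf hx⟩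

theorem mapsOnto_inf (h : F.StronglyClosed T) (hf : F.MapsOnto f P Q) :
    F.MapsOnto f (P ⊓ T) (Q ⊓ T) := by
  refine (hf.mapsOn.mono inf_le_left).mapsOnto (Set.Subset.antisymm ?_ fun z hz => ?_)
  · rintro _ ⟨y, hy, rfl⟩
    exact ⟨hf.apply_mem hy.1, (h.apply_mem_iff hf hy.1).2 hy.2⟩
  · obtain ⟨y, hy, rfl⟩ := hf.bijOn.surjOn hz.1
    exact ⟨y, ⟨hy, (h.apply_mem_iff hf hy).1 hz.2⟩, rfl⟩

theorem normalizerIn_le_normalizer_inf (h : F.StronglyClosed T) (hP : P ≤ S) :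
    normalizerIn S P ≤ normalizer ((P ⊓ T : Subgroup G) : Set G) := fun _ hs =>
  mem_normalizer_iff_conj_image_eq.2 (h.mapsOnto_inf (mapsOnto_conj hP hs)).bijOn.image_eq

theorem le_normalizer (h : F.StronglyClosed T) : S ≤ normalizer (T : Set G) := by
  have hS := h.normalizerIn_le_normalizer_inf le_rfl
  rw [inf_eq_right.2 h.1] at hS
  exact (le_normalizerIn_self le_rfl).trans hS

theorem normalizerIn_le_normalizer_normalizerIn (h : F.StronglyClosed T) :
    normalizerIn S Q ≤ normalizer (normalizerIn T Q : Set G) :=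
  (inf_le_inf h.le_normalizer Subgroup.le_normalizer).trans inf_normalizer_le_normalizer_inf

theorem target_le_normalizerIn (h : F.StronglyClosed T) (hf : F.MapsOnto f R R')
    (hf' : F.MapsOnto f Q Z) (hQ : Q ≤ R) (hR : R ≤ normalizerIn T Q) : R' ≤ normalizerIn T Z :=
  le_inf (hf.target_le_of_mapsTo fun _ hx => (h.apply_mem_iff hf hx).2 (hR hx).1)
    ((hf.le_normalizerIn hf' hQ (hR.trans inf_le_right)).trans inf_le_right)

theorem aut_le_autStab (h : F.StronglyClosed T) {hP : P ≤ S} :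
    F.aut P hP ≤ F.autStab hP (inf_le_left : P ⊓ T ≤ P) := fun _ ha =>
  have ⟨f, hf, haf⟩ := exists_mapsOnto ha
  mem_autStab_iff.2 ⟨f, hf, h.mapsOnto_inf hf, haf⟩

end StronglyClosed

namespace IsInvariantSubsystem

theorem map_aut_le (h : E.IsInvariantSubsystem F) {e : P ≃* P'} (he : e ∈ F.Iso P P')
    (hP : P ≤ T) (hP' : P' ≤ T) :
    (E.aut P hP).map (MulAut.congr e).toMonoidHom ≤ E.aut P' hP' := by
  obtain ⟨hEF, -, hinv, hfrat⟩ := h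
  obtain ⟨α, hα, φ₀, hφ₀, hφ⟩ := hfrat P hP _ (F.comp_mem he.1 (inclusion_mem_hom hP' hEF.1))
  obtain ⟨P₀, hP₀, e₀, he₀, he₀', rfl⟩ := E.exists_iso hφ₀
  have heα (x : P) : (e x : G) = α (inclusion hP₀ (e₀ x)) :=
    congrArg (fun ψ : P →* T => (ψ x : G)) hφ
  let b : P₀ ≃* P' := e₀.symm.trans e
  have hb : IsRestriction b.toMonoidHom α.toMonoidHom := by
    refine ⟨hP', hP₀, fun y => ?_⟩
    change (α (inclusion hP₀ y) : G) = e (e₀.symm y)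
    rw [heα, e₀.apply_symm_apply]
  have hbaut {c : MulAut P₀} (hc : c ∈ E.aut P₀ hP₀) :
      MulAut.congr b c ∈ E.aut P' hP' :=
    ⟨(hinv α hα _ _ _ _ b b hb hb _).1 hc.1, (hinv α hα _ _ _ _ b b hb hb _).1 hc.2⟩
  rintro _ ⟨a, ha, rfl⟩
  have hab : MulAut.congr e a = MulAut.congr b (MulAut.congr e₀ a) := MulEquiv.ext fun y => by
    change e (a (e.symm y)) = e (e₀.symm (e₀ (a (e₀.symm (e₀ (e.symm y))))))
    rw [e₀.symm_apply_apply, e₀.symm_apply_apply]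
  exact hab ▸ hbaut (FusionSystem.map_aut_le ⟨he₀, he₀'⟩ hP _ ⟨a, ha, rfl⟩)

theorem map_aut (h : E.IsInvariantSubsystem F) {e : P ≃* P'} (he : e ∈ F.Iso P P')
    (hP : P ≤ T) (hP' : P' ≤ T) :
    (E.aut P hP).map (MulAut.congr e).toMonoidHom = E.aut P' hP' := by
  refine le_antisymm (h.map_aut_le he hP hP') ?_
  rw [map_equiv_eq_comap_symm', ← map_le_iff_le_comap]
  exact h.map_aut_le (e := e.symm) ⟨he.2, he.1⟩ hP' hP

theorem apply_mem_coreIn (h : E.IsInvariantSubsystem F) (hf : F.MapsOnto f R R')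
    (hf' : F.MapsOnto f P P') {hP : P ≤ T} {hP' : P' ≤ T} (hPR : P ≤ R) (hy : y ∈ R)
    (hyc : y ∈ E.coreIn p P hP) : f y ∈ E.coreIn p P' hP' := by
  obtain ⟨e, he, hef⟩ := id hf'
  exact hf.apply_mem_coreIn hf' hef (h.map_aut he hP hP') hPR hy
    ((h.2.1.apply_mem_iff hf hy).2 (coreIn_le hyc)) hyc

theorem aut_le_normalizer_pCore (h : E.IsInvariantSubsystem F) (hP : P ≤ T) :
    F.aut P (hP.trans h.1.1) ≤ normalizer (pCore p (E.aut P hP) : Set (MulAut P)) := by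
  refine le_normalizer_iff.2 fun a ha c hc => ?_
  have := map_pCore_le (p := p) _ (MulAut.congr a).toMonoidHom ⟨c, hc, rfl⟩
  rwa [h.map_aut ha hP hP] at this

end IsInvariantSubsystem

theorem isNormal_normalizerSystem (hQ : Q ≤ S) : (F.normalizerSystem Q hQ).IsNormal Q := by
  have hQN := le_normalizerIn_self hQ
  refine ⟨hQN, inf_le_right, ?_⟩
  rintro P R φ ⟨hP, hR, -, ψ, hψ, hres, α, -, hα⟩
  have hPQ := sup_le hP hQN
  have hRQ := sup_le hR hQN
  refine ⟨ψ, ⟨hPQ, hRQ, hψ, (inclusion le_sup_left).comp (ψ.comp (inclusion (sup_le le_rfl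
    le_sup_right))), ?_, ⟨le_sup_left, le_sup_left, fun x => rfl⟩, α, le_sup_right, le_sup_right,
    fun x => hα.choose_spec x⟩, hres, α, le_sup_right, hα⟩
  exact F.comp_mem (F.comp_mem (inclusion_mem_hom _ (hPQ.trans inf_le_left)) hψ)
    (inclusion_mem_hom _ (sup_le (hRQ.trans inf_le_left) hQ))

theorem aut_le_aut_normalizerSystem (hQ : Q ≤ S) :
    F.aut Q hQ ≤ (F.normalizerSystem Q hQ).aut Q (le_normalizerIn_self hQ) := by
  have hQN := le_normalizerIn_self hQ
  have key {a : MulAut Q} (ha : a ∈ F.aut Q hQ) :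
      a.toMonoidHom ∈ (F.normalizerSystem Q hQ).Hom Q Q :=
    ⟨hQN, hQN, ha.1, (inclusion le_sup_left).comp
      (a.toMonoidHom.comp (inclusion (sup_le le_rfl le_rfl))),
      F.comp_mem (F.comp_mem (inclusion_mem_hom _ hQ) ha.1)
        (inclusion_mem_hom _ (sup_le hQ hQ)),
      ⟨le_sup_left, le_sup_left, fun x => rfl⟩, a, le_sup_left, le_sup_left, fun x => rfl⟩
  exact fun a ha => ⟨key ha, key (inv_mem ha)⟩

theorem IsNormal.aut_le_normalizer_autS (hM : F.IsNormal M) (hQ : Q ≤ S) :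
    F.aut Q hQ ≤ normalizer (autS M Q : Set (MulAut Q)) := by
  refine le_normalizer_iff.2 ?_
  rintro a ha _ ⟨⟨m, hmQ⟩, hm, rfl⟩
  obtain ⟨ψ, hψ, ⟨-, hQM, hψa⟩, α, -, hMQ, hψα⟩ := hM.2.2 Q Q _ ha.1
  obtain ⟨f, R, -, hf, hψf⟩ := exists_mapsOnto_of_hom hψ
  have haf (x : Q) : (a x : G) = f x := (hψa x).symm.trans (hψf _)
  have hfm : f m ∈ M := (hψα ⟨m, mem_subgroupOf.1 hm⟩).symm.trans (hψf _) ▸ (α _).2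
  have hmR : m ∈ Q ⊔ M := hMQ (mem_subgroupOf.1 hm)
  have hfn := hf.apply_mem_normalizer ⟨a, ha, haf⟩ hQM hmR hmQ
  exact ⟨⟨f m, hfn⟩, mem_subgroupOf.2 hfm,
    (hf.congr_normalizerMonoidHom haf hQM hmR hmQ hfn).symm⟩

theorem IsNormal.le_coreIn (hS : IsPGroup p S) {hQ : Q ≤ S}
    (hM : (F.normalizerSystem Q hQ).IsNormal M) : M ≤ F.coreIn p Q hQ := by
  intro m hm
  have hMQ := hM.1
  refine mem_coreIn_iff.2 ⟨(hMQ hm).1, _, le_pCore (N := autS M Q)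
    ((autS_mono (hMQ.trans inf_le_left) Q).trans (autS_le_aut hQ))
    ((aut_le_aut_normalizerSystem hQ).trans (hM.aut_le_normalizer_autS _))
    (isPGroup_autS (hS.to_le (hMQ.trans inf_le_left)) Q)
    ⟨_, mem_subgroupOf.2 hm, rfl⟩, (hMQ hm).2, rfl⟩

theorem inf_centralizer_le_coreIn {hP : P ≤ S} :
    S ⊓ centralizer (P : Set G) ≤ F.coreIn p P hP := by
  intro y hy
  refine mem_coreIn_iff.2 ⟨hy.1, 1, one_mem _, centralizer_le_normalizer _ hy.2, ?_⟩
  refine MulEquiv.ext fun x => Subtype.ext ?_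
  change y * x * y⁻¹ = x
  rw [← mem_centralizer_iff.1 hy.2 x x.2, mul_inv_cancel_right]

theorem mem_centricRadical_of_coreIn_le (hS : IsPGroup p S) (hP : P ≤ S)
    (h : ∀ Q (hQ : Q ≤ S), F.IsConj P Q → F.coreIn p Q hQ ≤ Q) : P ∈ F.centricRadical := by
  refine ⟨⟨hP, fun Q hPQ => ?_⟩, fun Q hQ hPQ _ => ⟨isNormal_normalizerSystem hQ, fun M hM =>
    (hM.le_coreIn hS).trans (h Q hQ hPQ)⟩⟩
  obtain ⟨f, hf⟩ := hPQ.exists_mapsOnto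
  exact inf_centralizer_le_coreIn.trans (h Q hf.target_le hPQ)

theorem IsSaturated.exists_normalizerEmbeds_coreIn_not_le [Fact p.Prime] [Finite S]
    (hS : IsPGroup p S) (hF : F.IsSaturated p) (hP : P ≤ S) (h : P ∉ F.centricRadical) :
    ∃ Q, ∃ hQ : Q ≤ S, F.NormalizerEmbeds P Q ∧ ¬F.coreIn p Q hQ ≤ Q := by
  obtain ⟨P₁, hP₁, hconj, hcore⟩ :
      ∃ P₁, ∃ hP₁ : P₁ ≤ S, F.IsConj P P₁ ∧ ¬F.coreIn p P₁ hP₁ ≤ P₁ := by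
    by_contra! H
    exact h (mem_centricRadical_of_coreIn_le hS hP H)
  obtain ⟨f, Q, Z, hf, hfZ, hw⟩ := IsSaturatedAt.exists_wellPlaced hS (hF P₁ hP₁) (le_refl P₁)
  obtain rfl := hf.target_unique hfZ
  obtain ⟨c, hc⟩ := hconj.exists_mapsOnto
  obtain ⟨u, hu, huQ, -⟩ := hw.exists_extension_normalizerIn hS (hc.comp hf) (hc.comp hf) le_rfl
  obtain ⟨v, ⟨B, hv⟩, hvQ, -⟩ := hw.exists_extension_coreIn (hX := hP₁) hS hf hf le_rfl
  refine ⟨Q, hf.target_le, ⟨u, hu.mono (le_sup_of_le_right (le_inf le_rfl inf_le_right)), huQ⟩,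
    fun hle => hcore fun y hy => ?_⟩
  have hyv : y ∈ P₁ ⊔ F.coreIn p P₁ hP₁ ⊓ normalizer (P₁ : Set G) :=
    mem_sup_right ⟨hy, (coreIn_le_normalizerIn hy).2⟩
  exact (hv.mem_iff hvQ le_sup_left hyv).1
    (hle ((hv.mem_coreIn_iff hvQ le_sup_left hP₁ hf.target_le hyv).2 hy))

end FusionSystem

end Invariant

section Quotient

theorem pow_apply_eq_mul_pow {H : Type*} [Group H] {d : MulAut H} {x : H}
    (h : d (x⁻¹ * d x) = x⁻¹ * d x) (n : ℕ) : (d ^ n) x = x * (x⁻¹ * d x) ^ n := by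
  induction n with
  | zero => rw [pow_zero, pow_zero, mul_one, MulAut.one_apply]
  | succ n ih =>
    rw [pow_succ', MulAut.mul_apply, ih, map_mul, map_pow, h, pow_succ', ← mul_assoc x,
      mul_inv_cancel_left]

variable {G : Type*} [Group G] {S T : Subgroup G} {p : ℕ}

/-- The automorphisms of `P` that map each coset of `P ⊓ T` in `P` to itself. -/
def autTrivialMod (P T : Subgroup G) : Subgroup (MulAut P) where
  carrier := {a | ∀ x : P, (x : G)⁻¹ * a x ∈ T}
  one_mem' x := by
    rw [MulAut.one_apply, inv_mul_cancel]
    exact one_mem _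
  mul_mem' {a b} ha hb x := by
    have := mul_mem (hb x) (ha (b x))
    rwa [mul_assoc, mul_inv_cancel_left] at this
  inv_mem' {a} ha x := by
    have := inv_mem (ha (a⁻¹ x))
    rwa [MulAut.apply_inv_self, mul_inv_rev, inv_inv] at this

namespace FusionSystem

variable {F : FusionSystem S} {E : FusionSystem T} {P : Subgroup G} {hP : P ≤ S}

theorem isPGroup_autOver_inf_autTrivialMod [Fact p.Prime] [Finite S] (hS : IsPGroup p S)
    {C : Subgroup (MulAut (P ⊓ T : Subgroup G))} (hC : IsPGroup p C) :
    IsPGroup p (F.autOver hP inf_le_left C ⊓ autTrivialMod P T : Subgroup (MulAut P)) := by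
  have := finite_of_le (inf_le_left.trans hP : P ⊓ T ≤ S)
  have := finite_of_le hP
  obtain ⟨k, hk⟩ := IsPGroup.iff_card.1 hC
  obtain ⟨m, hm⟩ := IsPGroup.iff_card.1 (hS.to_le hP)
  rintro ⟨a, ha⟩
  refine ⟨k + m, Subtype.ext (MulEquiv.ext fun x => ?_)⟩
  obtain ⟨-, c, hc, hdc⟩ := pow_mem_autOver (n := p ^ k) (D := ⊥) ha.1 fun c hc => by
    rw [mem_bot, ← hk]
    exact congrArg Subtype.val (pow_card_eq_one' (x := (⟨c, hc⟩ : C)))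
  have hfix : (a ^ p ^ k) (x⁻¹ * (a ^ p ^ k) x) = x⁻¹ * (a ^ p ^ k) x := by
    have hxT : ((x⁻¹ * (a ^ p ^ k) x : P) : G) ∈ P ⊓ T := ⟨Subtype.prop _, pow_mem ha.2 _ x⟩
    have := hdc ⟨_, hxT⟩
    rwa [mem_bot.1 hc] at this
  change (a ^ p ^ (k + m)) x = x
  rw [pow_add, pow_mul, pow_apply_eq_mul_pow hfix, ← hm, pow_card_eq_one', mul_one]

theorem StronglyClosed.aut_le_normalizer_autTrivialMod (h : F.StronglyClosed T) :
    F.aut P hP ≤ normalizer (autTrivialMod P T : Set (MulAut P)) := by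
  refine le_normalizer_iff.2 fun a ha b hb x => ?_
  obtain ⟨f, hf, haf⟩ := exists_mapsOnto ha
  have hab : a ((a⁻¹ x)⁻¹ * b (a⁻¹ x)) = x⁻¹ * (a * b * a⁻¹) x := by
    rw [map_mul, map_inv, MulAut.apply_inv_self]
    rfl
  change ((x⁻¹ * (a * b * a⁻¹) x : P) : G) ∈ T
  rw [← hab, haf]
  exact (h.apply_mem_iff hf (Subtype.prop _)).2 (hb (a⁻¹ x))

namespace IsInvariantSubsystem

theorem coreIn_inf_normalizer_le [Fact p.Prime] [Finite S] (hS : IsPGroup p S)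
    (h : E.IsInvariantSubsystem F) :
    E.coreIn p (P ⊓ T) inf_le_right ⊓ normalizer (P : Set G) ≤ F.coreIn p P hP := by
  rintro k ⟨hk, hkP⟩
  obtain ⟨hkT, b, hb, hkn, hkb⟩ := mem_coreIn_iff.1 hk
  have hT := h.2.1
  have hkS := hT.1 hkT
  have hle : F.aut P hP ≤ F.autStab hP (inf_le_left : P ⊓ T ≤ P) := hT.aut_le_autStab
  have hkaut : P.normalizerMonoidHom ⟨k, hkP⟩ ∈ F.aut P hP :=
    mem_aut_of_mapsOnto (mapsOnto_conj hP ⟨hkS, hkP⟩) fun x => rfl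
  refine mem_coreIn_iff.2 ⟨hkS, _, le_pCore
    (N := F.autOver hP inf_le_left (pCore p (E.aut (P ⊓ T) inf_le_right)) ⊓ autTrivialMod P T)
    (fun a ha => ha.1.1) ?_ (isPGroup_autOver_inf_autTrivialMod hS (isPGroup_pCore _))
    ⟨⟨hkaut, b, hb, fun z => ?_⟩, fun x => ?_⟩, hkP, rfl⟩
  · exact (le_inf (hle.trans (autOver_le_normalizer (h.aut_le_normalizer_pCore inf_le_right)))
      hT.aut_le_normalizer_autTrivialMod).trans inf_normalizer_le_normalizer_inf
  · exact hkb ▸ rfl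
  · change (x : G)⁻¹ * (k * x * k⁻¹) ∈ T
    have := mul_mem ((mem_normalizer_iff''.1 (hT.le_normalizer (hP x.2)) k).1 hkT) (inv_mem hkT)
    rwa [mul_assoc, mul_assoc, ← mul_assoc k] at this

theorem le_normalizer_coreIn (h : E.IsInvariantSubsystem F) (hP : P ≤ S) :
    P ≤ normalizer (E.coreIn p (P ⊓ T) inf_le_right : Set G) := by
  refine le_normalizer_iff.2 fun g hg y hy => ?_
  have hT := h.2.1
  exact h.apply_mem_coreIn (mapsOnto_conj hT.1 ⟨hP hg, hT.le_normalizer (hP hg)⟩)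
    (hT.mapsOnto_inf (mapsOnto_conj hP ⟨hP hg, le_normalizer hg⟩)) inf_le_right (coreIn_le hy) hy

theorem coreIn_not_le [Fact p.Prime] [Finite S] (hS : IsPGroup p S)
    (h : E.IsInvariantSubsystem F) (hK : ¬E.coreIn p (P ⊓ T) inf_le_right ≤ P ⊓ T) :
    ¬F.coreIn p P hP ≤ P := by
  have hPK : P ⊔ E.coreIn p (P ⊓ T) inf_le_right ≤ S := sup_le hP (coreIn_le.trans h.2.1.1)
  have := finite_of_le hPK
  have hlt := lt_sup_inf_normalizer (h.le_normalizer_coreIn hP)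
    (fun hle => hK (le_inf hle coreIn_le)) (hS.to_le hPK)
  exact fun hle => hlt.not_ge (sup_le le_rfl ((h.coreIn_inf_normalizer_le hS).trans hle))

end IsInvariantSubsystem

end FusionSystem

end Quotient

section MinimalCounterexample

variable {G : Type*} [Group G] {S T : Subgroup G} {p : ℕ}

theorem finite_setOf_le [Finite S] : {P : Subgroup G | P ≤ S}.Finite :=
  Set.finite_coe_iff.1 (Finite.of_equiv _ (MapSubtype.orderIso S).toEquiv)

/-- The orders of `P ⊓ T` and of `P`, compared lexicographically: the measure along which saturation
at the subgroups of `S` is proved by downward induction. -/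
noncomputable def lexCard (T P : Subgroup G) : ℕ ×ₗ ℕ :=
  toLex (Nat.card (P ⊓ T : Subgroup G), Nat.card P)

theorem lexCard_lt_of_lt [Finite S] {P R : Subgroup G} (h : P < R) (hR : R ≤ S) :
    lexCard T P < lexCard T R :=
  Prod.Lex.toLex_lt_toLex'.2 ⟨card_le_card_of_le (inf_le_inf_right T h.le) (inf_le_left.trans hR),
    fun _ => card_lt_card_of_lt h hR⟩

theorem lexCard_lt_of_inf_lt [Finite S] {P R : Subgroup G} (h : P ⊓ T < R) (hRT : R ≤ T)
    (hR : R ≤ S) : lexCard T P < lexCard T R :=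
  Prod.Lex.toLex_lt_toLex.2 (.inl (card_lt_card_of_lt
    (h.trans_le (le_inf le_rfl hRT)) (inf_le_left.trans hR)))

namespace FusionSystem

variable {F : FusionSystem S} {E : FusionSystem T} {f g : G → G} {P Q N Z : Subgroup G}
  {Δ : Set (Subgroup G)}

theorem StronglyClosed.lexCard_eq (h : F.StronglyClosed T) (hPQ : F.IsConj P Q) :
    lexCard T P = lexCard T Q := by
  obtain ⟨f, hf⟩ := hPQ.exists_mapsOnto
  rw [lexCard, lexCard, (h.mapsOnto_inf hf).card_eq, hf.card_eq]

theorem NormalizerEmbeds.card_le [Finite S] (h : F.NormalizerEmbeds P Q) :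
    Nat.card (normalizerIn S P) ≤ Nat.card (normalizerIn S Q) := by
  obtain ⟨f, ⟨B, hB⟩, hf⟩ := h
  exact hB.card_eq ▸ card_le_card_of_le
    (hB.le_normalizerIn hf (le_normalizerIn_self hf.source_le) inf_le_right) inf_le_left

theorem exists_isConj_forall_card_le [Finite S] (hP : P ≤ S) (T : Subgroup G) :
    ∃ Q, F.IsConj P Q ∧
      (∀ W, F.IsConj P W → Nat.card (normalizerIn S W) ≤ Nat.card (normalizerIn S Q)) ∧
      ∀ W, F.IsConj P W → Nat.card (normalizerIn S Q) ≤ Nat.card (normalizerIn S W) →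
        Nat.card (normalizerIn T (W ⊓ T)) ≤ Nat.card (normalizerIn T (Q ⊓ T)) := by
  have hfin : {Q | F.IsConj P Q}.Finite := (finite_setOf_le (S := S)).subset fun Q hPQ =>
    have ⟨_, hf⟩ := hPQ.exists_mapsOnto
    hf.target_le
  obtain ⟨Q, hPQ, hmax⟩ := Set.exists_max_image _ (fun W : Subgroup G =>
    toLex (Nat.card (normalizerIn S W), Nat.card (normalizerIn T (W ⊓ T)))) hfin
    ⟨P, (mapsOnto_id hP).isConj⟩
  have hmax' (W) (hW : F.IsConj P W) := Prod.Lex.toLex_le_toLex'.1 (hmax W hW)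
  exact ⟨Q, hPQ, fun W hW => (hmax' W hW).1, fun W hW hle =>
    (hmax' W hW).2 (le_antisymm (hmax' W hW).1 hle)⟩

section

variable [Fact p.Prime] [Finite S]

theorem StronglyClosed.exists_normalizerEmbeds_wellPlaced (hS : IsPGroup p S)
    (h : F.StronglyClosed T) (hP : P ≤ S) (hsat : F.IsSaturatedAt p (normalizerIn T (P ⊓ T))) :
    ∃ f W R, F.NormalizerEmbeds P W ∧ F.MapsOnto f (normalizerIn T (P ⊓ T)) R ∧
      F.MapsOnto f (P ⊓ T) (W ⊓ T) ∧ F.WellPlaced p R (W ⊓ T) := by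
  have hQ : P ⊓ T ≤ normalizerIn T (P ⊓ T) := le_normalizerIn_self inf_le_right
  have hPQ : normalizerIn S P ≤ normalizerIn S (P ⊓ T) :=
    le_inf inf_le_left (h.normalizerIn_le_normalizer_inf hP)
  obtain ⟨c, R, Z, hc, hcZ, hw⟩ := hsat.exists_wellPlaced hS hQ
  obtain ⟨f, hf, hfR, hfZ⟩ := hw.exists_extension_normalizerIn hS hc hcZ hQ
  replace hf := hf.mono (P' := normalizerIn S P) <| le_sup_of_le_right <|
    le_inf (le_inf inf_le_left (hPQ.trans h.normalizerIn_le_normalizer_normalizerIn))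
      (hPQ.trans inf_le_right)
  obtain ⟨W, hfW⟩ := hf.mono (le_normalizerIn_self hP)
  obtain rfl := hfZ.target_unique (h.mapsOnto_inf hfW)
  exact ⟨f, W, R, ⟨f, hf, hfW⟩, hfR, hfZ, hw⟩

theorem WellPlaced.eq_normalizerIn (hS : IsPGroup p S) (hT : F.StronglyClosed T)
    (hw : F.WellPlaced p (normalizerIn T Z) Z) (hg : F.MapsOnto g N (normalizerIn T Z))
    (hgQ : F.MapsOnto g Q Z) (hQN : Q ≤ N) (hN : N ≤ normalizerIn T Q) :
    N = normalizerIn T Q := by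
  by_contra hne
  have := finite_of_le (inf_le_left.trans hT.1 : normalizerIn T Q ≤ S)
  have hlt := lt_inf_normalizer (hS.to_le (inf_le_left.trans hT.1)) (hN.lt_of_ne hne)
  obtain ⟨v, hv, -, hvZ⟩ := hw.exists_extension_normalizerIn hS hg hgQ hQN
  obtain ⟨D, hD⟩ := hv.mono (P' := normalizerIn T Q ⊓ normalizer (N : Set G)) <|
    le_sup_of_le_right <| le_inf (inf_le_inf_right _ (inf_le_left.trans hT.1))
      (inf_le_left.trans inf_le_right)
  have hDZ := hT.target_le_normalizerIn hD hvZ (hQN.trans hlt.le) inf_le_left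
  have hcard := card_lt_card_of_lt hlt hD.source_le
  rw [hD.card_eq, hg.card_eq] at hcard
  exact hcard.not_ge (card_le_card_of_le hDZ hg.target_le)

namespace IsInvariantSubsystem

theorem exists_normalizerEmbeds_coreIn_not_le (hS : IsPGroup p S) (h : E.IsInvariantSubsystem F)
    (hE : E.IsSaturated p) (hP : P ≤ S) (hcr : P ⊓ T ∉ E.centricRadical)
    (hsat : ∀ R ≤ T, P ⊓ T < R → F.IsSaturatedAt p R)
    (hmax : ∀ W, F.NormalizerEmbeds P W →
      Nat.card (normalizerIn T (W ⊓ T)) ≤ Nat.card (normalizerIn T (P ⊓ T))) :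
    ∃ W, ∃ hW : W ≤ S, F.NormalizerEmbeds P W ∧ ¬F.coreIn p W hW ≤ W := by
  have hT := h.2.1
  have := finite_of_le hT.1
  have hTp := hS.to_le hT.1
  obtain ⟨Q, hQ, ⟨φ, ⟨N, hφ⟩, hφQ⟩, hcore⟩ :=
    hE.exists_normalizerEmbeds_coreIn_not_le hTp inf_le_right hcr
  have hPT : P ⊓ T ≠ T := fun heq => hcore <| coreIn_le.trans
    (eq_of_le_of_card_ge hQ (hφQ.card_eq ▸ heq.symm ▸ le_rfl)).ge
  have hlt : P ⊓ T < normalizerIn T (P ⊓ T) := lt_inf_normalizer hTp (inf_le_right.lt_of_ne hPT)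
  obtain ⟨u, W, R, hPW, hu, huQ, hw⟩ :=
    hT.exists_normalizerEmbeds_wellPlaced hS hP (hsat _ inf_le_left hlt)
  have := finite_of_le (inf_le_left : normalizerIn T (W ⊓ T) ≤ T)
  obtain rfl : R = normalizerIn T (W ⊓ T) := eq_of_le_of_card_ge
    (hT.target_le_normalizerIn hu huQ hlt.le le_rfl) (hu.card_eq ▸ hmax W hPW)
  obtain ⟨ψ, hψ, hψφ, -⟩ := (h.1.mapsOnto hφ).exists_invOn
  have hg := hψ.comp hu
  have hgQ := ((h.1.mapsOnto hφQ).of_leftInvOn (hψφ.mono hlt.le)).comp huQ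
  have hQN := hφ.target_mono hφQ hlt.le
  obtain rfl := hw.eq_normalizerIn hS hT hg hgQ hQN (hφ.le_normalizerIn hφQ hlt.le inf_le_right)
  obtain ⟨_, _, hW⟩ := id hPW
  refine ⟨W, hW.target_le, hPW, h.coreIn_not_le hS fun hle => hcore fun y hy => ?_⟩
  have hyN := coreIn_le_normalizerIn hy
  exact (hg.mem_iff hgQ hQN hyN).1
    (hle (h.apply_mem_coreIn (hP' := inf_le_right) hg hgQ hQN hyN hy))

theorem isSaturatedAt (hS : IsPGroup p S) (h : E.IsInvariantSubsystem F) (hE : E.IsSaturated p)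
    (hgen : F.IsGeneratedBy Δ) (hP : P ≤ S) (hΔ : ∀ Q, F.IsConj P Q → Q ∉ Δ)
    (hcr : ∀ Q, F.IsConj P Q → Q ⊓ T ∉ E.centricRadical)
    (hsat : ∀ R ≤ S, lexCard T P < lexCard T R → F.IsSaturatedAt p R) : F.IsSaturatedAt p P := by
  have hT := h.2.1
  obtain ⟨Q, hPQ, hmaxS, hmaxT⟩ := F.exists_isConj_forall_card_le hP T
  obtain ⟨_, hQ⟩ := hPQ.exists_mapsOnto
  obtain ⟨W, hW, hQW, hcore⟩ := h.exists_normalizerEmbeds_coreIn_not_le hS hE hQ.target_le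
    (hcr Q hPQ) (fun R hR hlt => hsat R (hR.trans hT.1)
      (hT.lexCard_eq hPQ ▸ lexCard_lt_of_inf_lt hlt hR (hR.trans hT.1)))
    fun W hQW => hmaxT W (hPQ.trans hQW.isConj) hQW.card_le
  have hPW : F.IsConj P W := hPQ.trans hQW.isConj
  refine IsSaturatedAt.of_isConj ?_ hPW.symm
  exact isSaturatedAt_of_coreIn_not_le hS hgen (fun V hV => hΔ V (hPW.trans hV))
    (fun V hV R hR hlt => hsat R hR
      (hT.lexCard_eq (hPW.trans hV) ▸ lexCard_lt_of_lt hlt hR))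
    (fun V hV => (hmaxS V (hPW.trans hV)).trans hQW.card_le) hcore

end IsInvariantSubsystem

end

end FusionSystem

end MinimalCounterexample

open FusionSystem

theorem theorem1_general {p : ℕ} [Fact p.Prime] {G : Type*} [Group G] {S T : Subgroup G}
    [Finite S] (hS : IsPGroup p S) {F : FusionSystem S} {E : FusionSystem T}
    (hEF : E.IsInvariantSubsystem F) (hE : E.IsSaturated p) {Δ : Set (Subgroup G)}
    (hgen : F.IsGeneratedBy Δ) (hsat : F.IsSaturatedOn p Δ)
    (hcr : ∀ P ≤ S, P ⊓ T ∈ E.centricRadical → P ∈ Δ) : F.IsSaturated p := by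
  by_contra h
  obtain ⟨P₀, hP₀⟩ : ∃ P, P ≤ S ∧ ¬F.IsSaturatedAt p P := by
    by_contra! H
    exact h H
  obtain ⟨P, ⟨hP, hPsat⟩, hmax⟩ := Set.exists_max_image {P | P ≤ S ∧ ¬F.IsSaturatedAt p P}
    (lexCard T) (finite_setOf_le.subset fun _ h => h.1) ⟨P₀, hP₀⟩
  have hΔ (Q) (hPQ : F.IsConj P Q) : Q ∉ Δ := fun hQ =>
    hPsat (IsSaturatedAt.of_isConj (hsat Q hQ) hPQ.symm)
  refine hPsat (hEF.isSaturatedAt hS hE hgen hP hΔ (fun Q hPQ hQ => ?_) fun R hR hlt => ?_)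
  · obtain ⟨f, hf⟩ := hPQ.exists_mapsOnto
    exact hΔ Q hPQ (hcr Q hf.target_le hQ)
  · by_contra hRsat
    exact hlt.not_ge (hmax R ⟨hR, hRsat⟩)

theorem theorem1 {p : ℕ} [Fact p.Prime] {G : Type*} [Group G]
    (S : Subgroup G) [Finite S] (hS : IsPGroup p S) (F : FusionSystem S)
    (T : Subgroup G) (E : FusionSystem T)
    (hEF : E.IsInvariantSubsystem F) (hE : E.IsSaturated p)
    (Δ : Set (Subgroup G)) (hΔ : F.IsClosedSet Δ)
    (hgen : F.IsGeneratedBy Δ) (hsat : F.IsSaturatedOn p Δ)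
    (hcr : E.centricRadical ⊆ Δ) :
    F.IsSaturated p :=
  theorem1_general hS hEF hE hgen hsat fun P hP h => hΔ.2.2 _ (hcr h) P inf_le_left hP
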